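/- Let $(R,\mathfrak m,k)$ be a local ring, that is, a commutative noetherian ring with unique maximal ideal $\mathfrak m$ and residue field $k=R/\mathfrak m$, and let $N$ be an arbitrary $R$-module. Let $F\to k$ and $G\to N$ be projective resolutions. Let $\operatorname{Hom}_R(F,G)$ be the complex with $\operatorname{Hom}_R(F,G)^n=\prod_{i}\operatorname{Hom}_R(F_i,G_{i-n})$ and differential $\beta\mapsto\partial^G\beta-(-1)^{n}\beta\,\partial^F$ on elements of degree $n$, and let $\overline{\operatorname{Hom}}_R(F,G)$ be its subcomplex of bounded homomorphisms, i.e. of those $\beta=(\beta_i)$ with $\beta_i=0$ for all $i\gg0$. The bounded cohomology of $k$ and $N$ is $$\overline{\operatorname{Ext}}{}^{\,n}_R(k,N)=\operatorname{H}^n\bigl(\overline{\operatorname{Hom}}_R(F,G)\bigr)\qquad(n\in\mathbb Z).$$ It is annihilated by $\mathfrak m$, hence is a $k$-vector space. The graded algebra $\operatorname{Ext}_R(N,N)=\operatorname{H}(\operatorname{Hom}_R(G,G))$ acts from the left on $\overline{\operatorname{Ext}}_R(k,N)$ by composition, $[\alpha]\cdot[\beta]=[\alpha\beta]$; on $\operatorname{Tor}^R(k,N)=\operatorname{H}(k\otimes_RG)$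 by evaluation, $[\alpha]\cdot[s\otimes g]=[s\otimes\alpha(g)]$, so that an element of degree $a$ maps $\operatorname{Tor}^R_j(k,N)$ to $\operatorname{Tor}^R_{j-a}(k,N)$; and on $\operatorname{Ext}_R(k,R)\otimes_k\operatorname{Tor}^R(k,N)$, where $\operatorname{Ext}^i_R(k,R)\otimes_k\operatorname{Tor}_j^R(k,N)$ has degree $i-j$, by $$\varepsilon\cdot(x\otimes t)=(-1)^{ai}\,x\otimes(\varepsilon\cdot t)\qquad\text{for }\varepsilon\in\operatorname{Ext}^a_R(N,N),\ x\in\operatorname{Ext}^i_R(k,R),\ t\in\operatorname{Tor}^R(k,N).$$ Then there is an isomorphism $$\overline{\operatorname{Ext}}_R(k,N)\;\cong\;\operatorname{Ext}_R(k,R)\otimes_k\operatorname{Tor}^R(k,N)$$ of graded left $\operatorname{Ext}_R(N,N)$-modules, which is $k$-linear. In particular, for every $n\in\mathbb Z$ there is an isomorphism of $k$-vector spaces $$\overline{\operatorname{Ext}}{}^{\,n}_R(k,N)\;\cong\;\coprod_{i-j=n}\operatorname{Ext}^i_R(k,R)\otimes_k\operatorname{Tor}^R_j(k,N).$$ -/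

import Mathlib

open CategoryTheory CochainComplex CochainComplex.HomComplex
open scoped TensorProduct DirectSum

universe u

noncomputable section

namespace BoundedCohomology

/-! ## The bounded Hom complex -/

section BoundedHom

variable {R : Type u} [CommRing R] (K L : CochainComplex (ModuleCat.{u} R) ℤ)

/-- The bounded homomorphisms of cohomological degree `n` from `K` to `L`: those families
`β = (β_i : K_i ⟶ L_{i-n})` with `β_i = 0` for all `i ≫ 0`. Here `i` is the homological degree,
`K_i = K.X (-i)`, so that `i ≫ 0` means that the cohomological degree `p = -i` is `≪ 0`. -/
def boundedCochains (n : ℤ) : Submodule R (Cochain K L n) where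
  carrier := {β | ∃ b : ℤ, ∀ (p q : ℤ) (h : p + n = q), p < b → β.v p q h = 0}
  zero_mem' := ⟨0, fun _ _ _ _ => rfl⟩
  add_mem' := by
    rintro β γ ⟨b, hb⟩ ⟨c, hc⟩
    refine ⟨min b c, fun p q h hp => ?_⟩
    rw [Cochain.add_v, hb p q h (lt_of_lt_of_le hp (min_le_left _ _)),
      hc p q h (lt_of_lt_of_le hp (min_le_right _ _)), add_zero]
  smul_mem' := by
    rintro r β ⟨b, hb⟩
    exact ⟨b, fun p q h hp => by rw [Cochain.smul_v, hb p q h hp, smul_zero]⟩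

/-- The cocycles of degree `n` of the bounded Hom complex. The differential is the one of the
Hom complex, `β ↦ d ∘ β - (-1)^n β ∘ d`. -/
def boundedCocycles (n : ℤ) : Submodule R (Cochain K L n) :=
  boundedCochains K L n ⊓ LinearMap.ker (δ_hom R K L n (n + 1))

/-- The coboundaries of degree `n` of the bounded Hom complex: the differentials of the
*bounded* homomorphisms of degree `n - 1`. -/
def boundedCoboundaries (n : ℤ) : Submodule R (Cochain K L n) :=
  (boundedCochains K L (n - 1)).map (δ_hom R K L (n - 1) n)

/-- The cohomology in degree `n` of the bounded Hom complex. -/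
abbrev BoundedClass (n : ℤ) : Type u :=
  boundedCocycles K L n ⧸ (boundedCoboundaries K L n).submoduleOf (boundedCocycles K L n)

variable {K L}

lemma comp_mem_boundedCochains {L' : CochainComplex (ModuleCat.{u} R) ℤ} {n a m : ℤ}
    {β : Cochain K L n} (hβ : β ∈ boundedCochains K L n) (α : Cochain L L' a) (h : n + a = m) :
    β.comp α h ∈ boundedCochains K L' m := by
  obtain ⟨b, hb⟩ := hβ
  refine ⟨b, fun p q hq hp => ?_⟩
  rw [Cochain.comp_v β α h p (p + n) q rfl (by lia), hb p _ rfl hp, Limits.zero_comp]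

/-- Composition with a fixed cocycle `α` of degree `a`, as a map `β ↦ α ∘ β` on bounded
cocycles. (`Cochain.comp` takes its arguments in diagrammatic order.) -/
def boundedCocyclesMap {n a m : ℤ} (h : n + a = m) (α : Cocycle L L a) :
    boundedCocycles K L n →ₗ[R] boundedCocycles K L m where
  toFun β := ⟨β.1.comp α.1 h, comp_mem_boundedCochains β.2.1 _ h, by
      have h2 : δ n (n + 1) β.1 = 0 := β.2.2
      change δ m (m + 1) (β.1.comp α.1 h) = 0
      rw [δ_comp _ _ h (n + 1) (a + 1) (m + 1) rfl rfl rfl, h2, Cocycle.δ_eq_zero]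
      simp⟩
  map_add' β γ := Subtype.ext (Cochain.add_comp _ _ _ h)
  map_smul' r β := Subtype.ext (Cochain.smul_comp _ _ _ h)

/-- The action `[β] ↦ [α ∘ β]` of the class of a cocycle `α` of `Hom(L, L)` on the cohomology of
the bounded complex of homomorphisms from `K` to `L`. -/
def boundedClassAct {n a m : ℤ} (h : n + a = m) :
    CohomologyClass L L a →+ (BoundedClass K L n →ₗ[R] BoundedClass K L m) :=
  CohomologyClass.descAddMonoidHom
    { toFun := fun α => Submodule.mapQ _ _ (boundedCocyclesMap h α) (by
        rintro ⟨β, hβ⟩ ⟨γ, hγ, hγβ⟩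
        have hγβ' : δ (n - 1) n γ = β := hγβ
        have h' : n - 1 + a = m - 1 := by lia
        refine ⟨(a.negOnePow : ℤ) • γ.comp α.1 h',
          zsmul_mem (comp_mem_boundedCochains hγ _ h') _, ?_⟩
        change δ_hom R K L (m - 1) m _ = β.comp α.1 h
        rw [map_zsmul, δ_hom_apply, δ_comp γ α.1 h' n (a + 1) m (by lia) (by lia) rfl, hγβ',
          Cocycle.δ_eq_zero, Cochain.comp_zero, zero_add, ← Units.smul_def, smul_smul,
          Int.units_mul_self, one_smul])
      map_zero' := by
        ext x
        exact congrArg (Submodule.Quotient.mk) (Subtype.ext (Cochain.comp_zero _ h))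
      map_add' := fun α α' => by
        ext x
        exact congrArg (Submodule.Quotient.mk) (Subtype.ext (Cochain.comp_add _ _ _ h)) }
    (by
      rintro α ⟨c, hc, σ, hσ⟩
      rw [AddMonoidHom.mem_ker]
      ext x
      obtain ⟨β, hβ⟩ := x
      have h2 : δ n (n + 1) β = 0 := hβ.2
      have h' : n + c = m - 1 := by lia
      refine (Submodule.Quotient.mk_eq_zero _).2
        ⟨β.comp σ h', comp_mem_boundedCochains hβ.1 σ h', ?_⟩
      change δ (m - 1) m (β.comp σ h') = β.comp α.1 h
      rw [δ_comp β σ h' (n + 1) a m (by lia) rfl hc, h2, hσ]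
      simp)

end BoundedHom

/-! ## The action of `Hom(C, C)` on the homology of `C` -/

section Homology

variable {A : Type u} [CommRing A] (C : CochainComplex (ModuleCat.{u} A) ℤ)

/-- The cycles of homological degree `j` (that is, of cohomological degree `-j`) of `C`. -/
def cycles (j : ℤ) : Submodule A (C.X (-j)) :=
  LinearMap.ker (C.d (-j) (-j + 1)).hom

/-- The boundaries of homological degree `j` of `C`. -/
def boundaries (j : ℤ) : Submodule A (C.X (-j)) :=
  LinearMap.range (C.d (-j - 1) (-j)).hom

/-- The homology of `C` in homological degree `j`. -/
abbrev HomologyModule (j : ℤ) : Type u :=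
  cycles C j ⧸ (boundaries C j).submoduleOf (cycles C j)

variable {C}

lemma δ_v_apply {c a : ℤ} (hc : c + 1 = a) (σ : Cochain C C c) (p q p' q' : ℤ)
    (h : p + a = q) (hq' : p + c = q') (hp' : p + 1 = p') (x : C.X p) :
    ((δ c a σ).v p q h).hom x = (C.d q' q).hom ((σ.v p q' hq').hom x) +
      (a.negOnePow : ℤ) • (σ.v p' q (by lia)).hom ((C.d p p').hom x) := by
  rw [δ_v c a hc σ p q h q' p' (by lia) hp', Units.smul_def]
  rfl

/-- The map on cycles given by a cocycle of `Hom(C, C)` of cohomological degree `a`. -/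
def cyclesMap {a j l : ℤ} (h : l + a = j) (α : Cocycle C C a) : cycles C j →ₗ[A] cycles C l :=
  (α.1.v (-j) (-l) (by lia)).hom.restrict (by
    intro x hx
    have hx' : (C.d (-j) (-j + 1)).hom x = 0 := hx
    have e := δ_v_apply (rfl : a + 1 = a + 1) α.1 (-j) (-l + 1) (-j + 1) (-l)
      (by lia) (by lia) rfl x
    change (C.d (-l) (-l + 1)).hom _ = 0
    rw [Cocycle.δ_eq_zero, hx', map_zero, smul_zero, add_zero] at e
    exact e.symm)

/-- The action `[x] ↦ [α(x)]` of the class of a cocycle `α` of `Hom(C, C)` of cohomological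
degree `a` on the homology of `C`; it lowers homological degrees by `a`. -/
def homologyAct {a j l : ℤ} (h : l + a = j) :
    CohomologyClass C C a →+ (HomologyModule C j →ₗ[A] HomologyModule C l) :=
  CohomologyClass.descAddMonoidHom
    { toFun := fun α => Submodule.mapQ _ _ (cyclesMap h α) (by
        rintro ⟨x, hx⟩ ⟨y, hy⟩
        have hy' : (C.d (-j - 1) (-j)).hom y = x := hy
        have e := δ_v_apply (rfl : a + 1 = a + 1) α.1 (-j - 1) (-l) (-j) (-l - 1)
          (by lia) (by lia) (by lia) y
        rw [Cocycle.δ_eq_zero, hy'] at e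
        have e' : (C.d (-l - 1) (-l)).hom ((α.1.v (-j - 1) (-l - 1) (by lia)).hom y) =
            (a.negOnePow : ℤ) • (α.1.v (-j) (-l) (by lia)).hom x := by
          have e0 := eq_neg_of_add_eq_zero_left e.symm
          rw [e0, Int.negOnePow_succ, Units.val_neg, neg_smul, neg_neg]
        refine ⟨(a.negOnePow : ℤ) • (α.1.v (-j - 1) (-l - 1) (by lia)).hom y, ?_⟩
        change _ = (α.1.v (-j) (-l) (by lia)).hom x
        rw [map_zsmul, e', ← Units.smul_def, ← Units.smul_def, smul_smul,
          Int.units_mul_self, one_smul])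
      map_zero' := by
        ext x
        rfl
      map_add' := fun α α' => by
        ext x
        rfl }
    (by
      rintro α ⟨c, hc, σ, hσ⟩
      rw [AddMonoidHom.mem_ker]
      ext x
      obtain ⟨x, hx⟩ := x
      have hx' : (C.d (-j) (-j + 1)).hom x = 0 := hx
      refine (Submodule.Quotient.mk_eq_zero _).2
        ⟨(σ.v (-j) (-l - 1) (by lia)).hom x, ?_⟩
      have e := δ_v_apply hc σ (-j) (-l) (-j + 1) (-l - 1) (by lia) (by lia) rfl x
      rw [hσ, hx', map_zero, smul_zero, add_zero] at e
      exact e.symm)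

end Homology

/-! ## Ext, bounded Ext, and Tor over a local ring -/

section LocalRing

variable {R : Type u} [CommRing R]

/-- If `r` kills the module `M`, then multiplication by `r` is null-homotopic on every
projective resolution of `M`. -/
lemma exists_δ_eq_smul {M : ModuleCat.{u} R} (F : ProjectiveResolution M) (r : R)
    (hr : ∀ x : M, r • x = 0) :
    ∃ s : Cochain F.cochainComplex F.cochainComplex (-1),
      δ (-1) 0 s = r • Cochain.ofHom (𝟙 F.cochainComplex) := by
  have h : (r • 𝟙 F.complex) ≫ F.π = 0 := by
    apply HomologicalComplex.to_single_hom_ext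
    rw [HomologicalComplex.comp_f, HomologicalComplex.smul_f_apply, HomologicalComplex.id_f,
      Linear.smul_comp, Category.id_comp, HomologicalComplex.zero_f]
    have h0 : r • 𝟙 M = 0 := by
      ext x
      exact hr x
    rw [← Category.comp_id (F.π.f 0), ← Linear.comp_smul]
    have h1 : r • 𝟙 (((ChainComplex.single₀ (ModuleCat.{u} R)).obj M).X 0) = 0 := h0
    rw [h1, Limits.comp_zero]
  have e : HomologicalComplex.extendMap (r • 𝟙 F.complex) ComplexShape.embeddingDownNat =
      r • 𝟙 (F.complex.extend ComplexShape.embeddingDownNat) := by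
    ext1 n
    by_cases hn : ∃ k : ℕ, ComplexShape.embeddingDownNat.f k = n
    · obtain ⟨k, hk⟩ := hn
      rw [HomologicalComplex.extendMap_f _ _ hk]
      simp
    · exact (HomologicalComplex.isZero_extend_X _ _ _ (by simpa using hn)).eq_of_src _ _
  have H := (ProjectiveResolution.liftHomotopyZero (r • 𝟙 F.complex) h).extend
    ComplexShape.embeddingDownNat
  rw [e, HomologicalComplex.extendMap_zero] at H
  have H' : Homotopy (r • 𝟙 F.cochainComplex) 0 := H
  refine ⟨Cochain.ofHomotopy H', (δ_ofHomotopy H').trans ?_⟩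
  ext p
  simp

/-- The bounded cohomology `\overline{Ext}^n_R(M, N)`, computed from projective resolutions `F`
of `M` and `G` of `N`. -/
abbrev Extb {M N : ModuleCat.{u} R} (F : ProjectiveResolution M) (G : ProjectiveResolution N)
    (n : ℤ) : Type u :=
  BoundedClass F.cochainComplex G.cochainComplex n

lemma smul_extb_eq_zero {M N : ModuleCat.{u} R} (F : ProjectiveResolution M)
    (G : ProjectiveResolution N) (n : ℤ) (r : R) (hr : ∀ x : M, r • x = 0) (x : Extb F G n) :
    r • x = 0 := by
  obtain ⟨s, hs⟩ := exists_δ_eq_smul F r hr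
  obtain ⟨⟨β, hβ⟩, rfl⟩ := Submodule.mkQ_surjective _ x
  have h2 : δ n (n + 1) β = 0 := hβ.2
  have h' : -1 + n = n - 1 := by lia
  refine (Submodule.Quotient.mk_eq_zero _).2
    ⟨(n.negOnePow : ℤ) • s.comp β h', zsmul_mem ?_ _, ?_⟩
  · obtain ⟨b, hb⟩ := hβ.1
    refine ⟨b, fun p q hq hp => ?_⟩
    rw [Cochain.comp_v s β h' p (p + -1) q rfl (by lia), hb (p + -1) q (by lia) (by lia),
      Limits.comp_zero]
  · change δ_hom R _ _ (n - 1) n _ = r • β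
    rw [map_zsmul, δ_hom_apply, δ_comp s β h' 0 (n + 1) n (by lia) (by lia) rfl, h2, hs,
      Cochain.comp_zero, zero_add, ← Units.smul_def, smul_smul, Int.units_mul_self, one_smul,
      Cochain.smul_comp, Cochain.id_comp]

instance extendScalarsAdditive (A : Type u) [CommRing A] (f : R →+* A) :
    (ModuleCat.extendScalars.{u, u, u} f).Additive where
  map_add {X Y g h} := by
    apply ModuleCat.hom_ext
    let : Algebra R A := f.toAlgebra
    exact LinearMap.baseChange_add g.hom h.hom

/-- The graded ring `Ext_R(N, N)`, computed from a projective resolution `G` of `N` as the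
cohomology of the complex `Hom(G, G)`, with composition as product. -/
abbrev SelfExt {N : ModuleCat.{u} R} (G : ProjectiveResolution N) (a : ℤ) : Type u :=
  CohomologyClass G.cochainComplex G.cochainComplex a

/-- The left action of `Ext^a_R(N, N)` on `\overline{Ext}_R(M, N)`, induced by composition of
homomorphisms: `[α] • [β] = [α ∘ β]`. -/
abbrev extbAct {M N : ModuleCat.{u} R} (F : ProjectiveResolution M) (G : ProjectiveResolution N)
    {n a m : ℤ} (h : n + a = m) : SelfExt G a →+ (Extb F G n →ₗ[R] Extb F G m) :=
  boundedClassAct h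

variable [IsLocalRing R]

local notation "k" => IsLocalRing.ResidueField R

lemma smul_residueField_eq_zero (r : R) (hr : r ∈ IsLocalRing.maximalIdeal R) (x : k) :
    r • x = 0 := by
  rw [Algebra.smul_def, IsLocalRing.ResidueField.algebraMap_eq,
    (IsLocalRing.residue_eq_zero_iff r).2 hr, zero_mul]

/-- `\overline{Ext}^n_R(k, N)` is killed by the maximal ideal, hence a `k`-vector space. -/
instance extbModule {N : ModuleCat.{u} R} (F : ProjectiveResolution (ModuleCat.of R k))
    (G : ProjectiveResolution N) (n : ℤ) : Module k (Extb F G n) :=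
  Module.IsTorsionBySet.module (R := R) (I := IsLocalRing.maximalIdeal R)
    fun x r => smul_extb_eq_zero F G n r (smul_residueField_eq_zero r.1 r.2) x

variable (R) in
/-- The `R`-module `Ext^i_R(k, R)`. -/
abbrev ExtResidue (i : ℕ) : Type u :=
  Abelian.Ext.{u} (ModuleCat.of R k) (ModuleCat.of R R) i

lemma smul_extResidue_eq_zero (i : ℕ) (r : R) (hr : r ∈ IsLocalRing.maximalIdeal R)
    (x : ExtResidue R i) : r • x = 0 := by
  have h : r • 𝟙 (ModuleCat.of R k) = 0 := by
    ext x
    exact smul_residueField_eq_zero r hr x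
  rw [← Abelian.Ext.mk₀_id_comp x, ← Abelian.Ext.smul_comp, ← Abelian.Ext.mk₀_smul, h,
    Abelian.Ext.mk₀_zero, Abelian.Ext.zero_comp]

/-- `Ext^i_R(k, R)` is killed by the maximal ideal, hence a `k`-vector space. -/
instance extResidueModule (i : ℕ) : Module k (ExtResidue R i) :=
  Module.IsTorsionBySet.module (R := R) (I := IsLocalRing.maximalIdeal R)
    fun x r => smul_extResidue_eq_zero i r.1 r.2 x

/-- The complex of `k`-vector spaces `k ⊗_R G`. -/
abbrev residueTensor (G : CochainComplex (ModuleCat.{u} R) ℤ) :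
    CochainComplex (ModuleCat.{u} k) ℤ :=
  ((ModuleCat.extendScalars (algebraMap R k)).mapHomologicalComplex (.up ℤ)).obj G

/-- The `k`-vector space `Tor_j^R(k, N)`, computed from a projective resolution `G` of `N` as the
homology in degree `j` of the complex `k ⊗_R G`. -/
abbrev TorResidue {N : ModuleCat.{u} R} (G : ProjectiveResolution N) (j : ℤ) : Type u :=
  HomologyModule (residueTensor G.cochainComplex) j

/-- The map `α ↦ k ⊗ α` on cocycles. -/
def residueTensorCocycle (G : CochainComplex (ModuleCat.{u} R) ℤ) (a : ℤ) :
    Cocycle G G a →+ Cocycle (residueTensor G) (residueTensor G) a where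
  toFun α := Cocycle.mk (α.1.map (ModuleCat.extendScalars (algebraMap R k))) (a + 1) rfl
    (by rw [δ_map, Cocycle.δ_eq_zero, Cochain.map_zero])
  map_zero' := Cocycle.ext
    (Cochain.map_zero G G a (ModuleCat.extendScalars (algebraMap R k)))
  map_add' α α' := Cocycle.ext
    (Cochain.map_add α.1 α'.1 (ModuleCat.extendScalars (algebraMap R k)))

/-- The map `[α] ↦ [k ⊗ α]` on cohomology classes. -/
def residueTensorClass (G : CochainComplex (ModuleCat.{u} R) ℤ) (a : ℤ) :
    CohomologyClass G G a →+ CohomologyClass (residueTensor G) (residueTensor G) a :=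
  CohomologyClass.descAddMonoidHom
    ((CohomologyClass.mkAddMonoidHom _ _ a).comp (residueTensorCocycle G a)) (by
      rintro α ⟨c, hc, σ, hσ⟩
      rw [AddMonoidHom.mem_ker]
      refine (CohomologyClass.mk_eq_zero_iff _).2 ⟨c, hc,
        σ.map (ModuleCat.extendScalars (algebraMap R k)), ?_⟩
      rw [δ_map, hσ]
      rfl)

/-- The left action of `Ext^a_R(N, N)` on `Tor^R(k, N)`, induced by evaluation of homomorphisms:
`[α] • [s ⊗ g] = [s ⊗ α(g)]`. -/
def torAct {N : ModuleCat.{u} R} (G : ProjectiveResolution N) {a j l : ℤ} (h : l + a = j) :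
    SelfExt G a →+ (TorResidue G j →ₗ[k] TorResidue G l) :=
  (homologyAct h).comp (residueTensorClass G.cochainComplex a)

/-- The component of degree `n` of the graded `k`-vector space `Ext_R(k, R) ⊗_k Tor^R(k, N)`:
the direct sum of the spaces `Ext^i_R(k, R) ⊗_k Tor_j^R(k, N)` over all `i` and `j` with
`i - j = n`. -/
abbrev ExtTensorTor {N : ModuleCat.{u} R} (G : ProjectiveResolution N) (n : ℤ) : Type u :=
  ⨁ p : {p : ℕ × ℤ // (p.1 : ℤ) - p.2 = n}, ExtResidue R p.1.1 ⊗[k] TorResidue G p.1.2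

/-- The left action of `Ext^a_R(N, N)` on `Ext_R(k, R) ⊗_k Tor^R(k, N)`, given by
`ε • (x ⊗ t) = (-1)^(a i) x ⊗ (ε • t)` for `ε` of degree `a` and `x` in `Ext^i_R(k, R)`. -/
def extTensorTorAct {N : ModuleCat.{u} R} (G : ProjectiveResolution N) {n a m : ℤ}
    (h : n + a = m) (ε : SelfExt G a) : ExtTensorTor G n →ₗ[k] ExtTensorTor G m :=
  DirectSum.toModule k _ _ fun p =>
    ((a * p.1.1).negOnePow : ℤ) •
      (DirectSum.lof k {p : ℕ × ℤ // (p.1 : ℤ) - p.2 = m}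
          (fun p => ExtResidue R p.1.1 ⊗[k] TorResidue G p.1.2)
          ⟨(p.1.1, p.1.2 - a), by have := p.2; lia⟩ ∘ₗ
        LinearMap.lTensor (ExtResidue R p.1.1) (torAct G (by lia : p.1.2 - a + a = p.1.2) ε))

end LocalRing

end BoundedCohomology

end

/-! Take an injective resolution `I` of `R`, put the resolved modules back as `F_{-1} = k` and
`I^{-1} = R`, and consider the triple complex `Hom(F_{x-1}, I^{y-1} ⊗ G_q)` for `x, y ≥ 0`. Its
corner `x = y = 0` is removed, and families must vanish for `q ≪ 0`. In a fixed degree only finitely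
many points then remain.

The edge `y = 0` is the bounded complex of homomorphisms from `F` to `G`, because in a fixed degree
a lower bound on `q` is an upper bound on the index of `F`. The edge `x = 0` is `Hom(k, I ⊗ G)`,
which is `Hom(k, I) ⊗ G` since `k` is finite and each `G_q` is projective. Rows with `y > 0` are
exact because `I^{y-1} ⊗ G_q` is injective over a noetherian ring (`resolvedHom_rowsExact`). Columns
with `x > 0` are exact because `F_{x-1}` is projective and `G_q` is flat
(`resolvedHom_swap_rowsExact`). Hence a cocycle on either edge extends to a total cocycle, and a
total cocycle is a coboundary as soon as its restriction to one edge is.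

On the edge `x = 0`, `Hom(k, I)` is a complex of vector spaces, so it retracts up to homotopy onto
`Ext(k, R)` (`nonempty_socleRetract`). What is left is `Ext(k, R) ⊗_R G = Ext(k, R) ⊗_k (k ⊗_R G)`,
with homology `Ext(k, R) ⊗_k Tor(k, N)` because tensoring over a field is exact.

The two sides are compared through the total cocycles: `totalToExtb` and `totalToExtTensorTor` are
surjective with the same kernel (`ker_totalToExtb`). Cocycles of `Hom(G, G)` act on the whole triple
complex through the factor `G_q`, which gives linearity over `Ext_R(N, N)` once the comparison in
degree `n` is multiplied by `(-1)^n`. -/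

/-! ### Triple complexes and the restriction of total cocycles to an edge -/

/-- A triple complex of modules, first-quadrant in two of its directions, with pairwise
anticommuting differentials. -/
structure TripleComplex (R : Type u) [CommRing R] where
  X : ℕ → ℕ → ℤ → ModuleCat.{u} R
  dx (x y : ℕ) (q : ℤ) : X x y q →ₗ[R] X (x + 1) y q
  dy (x y : ℕ) (q : ℤ) : X x y q →ₗ[R] X x (y + 1) q
  dz (x y : ℕ) (q : ℤ) : X x y (q - 1) →ₗ[R] X x y q
  dx_dx (x y : ℕ) (q : ℤ) (m : X x y q) : dx (x + 1) y q (dx x y q m) = 0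
  dy_dy (x y : ℕ) (q : ℤ) (m : X x y q) : dy x (y + 1) q (dy x y q m) = 0
  dz_dz (x y : ℕ) (q : ℤ) (m : X x y (q - 1 - 1)) : dz x y q (dz x y (q - 1) m) = 0
  dx_dy (x y : ℕ) (q : ℤ) (m : X x y q) :
    dx x (y + 1) q (dy x y q m) = -dy (x + 1) y q (dx x y q m)
  dx_dz (x y : ℕ) (q : ℤ) (m : X x y (q - 1)) :
    dx x y q (dz x y q m) = -dz (x + 1) y q (dx x y (q - 1) m)
  dy_dz (x y : ℕ) (q : ℤ) (m : X x y (q - 1)) :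
    dy x y q (dz x y q m) = -dz x (y + 1) q (dy x y (q - 1) m)

namespace TripleComplex

variable {R : Type u} [CommRing R] (T : TripleComplex R)

/-- Families of elements of the terms of a triple complex. -/
abbrev Fam : Type u := ∀ (x y : ℕ) (q : ℤ), T.X x y q

variable {T} in
/-- The component at a point of the first differential of a family. -/
def dX (w : T.Fam) : T.Fam
  | 0, _, _ => 0
  | x + 1, y, q => T.dx x y q (w x y q)

variable {T} in
/-- The component at a point of the second differential of a family. -/
def dY (w : T.Fam) : T.Fam
  | _, 0, _ => 0
  | x, y + 1, q => T.dy x y q (w x y q)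

variable {T} in
/-- The component at a point of the third differential of a family. -/
def dZ (w : T.Fam) : T.Fam := fun x y q => T.dz x y q (w x y (q - 1))

/-- The total differential. -/
def d : T.Fam →ₗ[R] T.Fam where
  toFun w := fun x y q => dX w x y q + dY w x y q + dZ w x y q
  map_add' v w := by
    funext x y q
    rcases x with _ | x <;> rcases y with _ | y <;> simp [dX, dY, dZ] <;> abel
  map_smul' r w := by
    funext x y q
    rcases x with _ | x <;> rcases y with _ | y <;> simp [dX, dY, dZ]

lemma d_apply (w : T.Fam) (x y : ℕ) (q : ℤ) :
    T.d w x y q = dX w x y q + dY w x y q + dZ w x y q := rfl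

lemma d_d (w : T.Fam) : T.d (T.d w) = 0 := by
  funext x y q
  rcases x with _ | _ | x <;> rcases y with _ | _ | y <;>
    simp [d_apply, dX, dY, dZ, T.dx_dx, T.dy_dy, T.dz_dz, T.dx_dy, T.dx_dz, T.dy_dz] <;> abel

/-- The homogeneous families of total degree `n` with support in `S` and bounded in the third
direction. The degree is normalized so that the point `(x, y, q)` has degree `x + y + q - 1`. -/
def cochains (S : ℕ → ℕ → Prop) (n : ℤ) : Submodule R T.Fam where
  carrier := {w | (∃ b : ℤ, ∀ (x y : ℕ) (q : ℤ), q < b → w x y q = 0) ∧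
    ∀ (x y : ℕ) (q : ℤ), ¬ ((x : ℤ) + y + q = n + 1 ∧ S x y) → w x y q = 0}
  zero_mem' := ⟨⟨0, fun _ _ _ _ => rfl⟩, fun _ _ _ _ => rfl⟩
  add_mem' := by
    rintro v w ⟨⟨b, hb⟩, hv⟩ ⟨⟨c, hc⟩, hw⟩
    refine ⟨⟨min b c, fun x y q hq => ?_⟩, fun x y q h => ?_⟩
    · simp [hb x y q (lt_of_lt_of_le hq (min_le_left _ _)),
        hc x y q (lt_of_lt_of_le hq (min_le_right _ _))]
    · simp [hv x y q h, hw x y q h]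
  smul_mem' := by
    rintro r w ⟨⟨b, hb⟩, hw⟩
    exact ⟨⟨b, fun x y q hq => by simp [hb x y q hq]⟩, fun x y q h => by simp [hw x y q h]⟩

variable {T}

lemma cochains_mono {S S' : ℕ → ℕ → Prop} (h : ∀ x y, S x y → S' x y) {n : ℤ} {w : T.Fam}
    (hw : w ∈ T.cochains S n) : w ∈ T.cochains S' n :=
  ⟨hw.1, fun x y q hq => hw.2 x y q fun h' => hq ⟨h'.1, h _ _ h'.2⟩⟩

lemma d_mem_cochains {S : ℕ → ℕ → Prop} (h1 : ∀ x y, S x y → S (x + 1) y)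
    (h2 : ∀ x y, S x y → S x (y + 1)) {n m : ℤ} (hm : n + 1 = m) {w : T.Fam}
    (hw : w ∈ T.cochains S n) : T.d w ∈ T.cochains S m := by
  obtain ⟨⟨b, hb⟩, hw⟩ := hw
  refine ⟨⟨b, fun x y q hq => ?_⟩, fun x y q h => ?_⟩
  · have e : dZ w x y q = 0 := by simp [dZ, hb x y (q - 1) (by lia)]
    rw [d_apply, e]
    rcases x with _ | x <;> rcases y with _ | y <;> simp [dX, dY, hb _ _ _ hq]
  · have e : dZ w x y q = 0 := by
      simp only [dZ]
      rw [hw x y (q - 1) fun h' => h ⟨by lia, h'.2⟩, map_zero]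
    have e1 : dX w x y q = 0 := by
      rcases x with _ | x
      · rfl
      · simp only [dX]
        rw [hw x y q fun h' => h ⟨by push_cast; lia, h1 _ _ h'.2⟩, map_zero]
    have e2 : dY w x y q = 0 := by
      rcases y with _ | y
      · rfl
      · simp only [dY]
        rw [hw x y q fun h' => h ⟨by push_cast; lia, h2 _ _ h'.2⟩, map_zero]
    rw [d_apply, e, e1, e2, add_zero, add_zero]

variable (T) in
/-- The rows of positive height of the triple complex are exact. -/
structure RowsExact : Prop where
  injective (y : ℕ) (q : ℤ) : Function.Injective (T.dx 0 (y + 1) q)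
  exact (x y : ℕ) (q : ℤ) : Function.Exact (T.dx x (y + 1) q) (T.dx (x + 1) (y + 1) q)

/-- Killing the components of lowest level of a cocycle. -/
lemma RowsExact.exists_step (hT : T.RowsExact) {n l : ℤ} {r : T.Fam}
    (hr : r ∈ T.cochains (fun _ y => 0 < y) n) (hdr : T.d r = 0)
    (hl : ∀ (x y : ℕ) (q : ℤ), (y : ℤ) + q < l → r x y q = 0) :
    ∃ z ∈ T.cochains (fun _ y => 0 < y) (n - 1),
      ∀ (x y : ℕ) (q : ℤ), (y : ℤ) + q < l + 1 → (r - T.d z) x y q = 0 := by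
  -- The differentials in `y` and `z` raise the level `y + q`, while the one in `x` preserves it. So
  -- on the lowest level the cocycle condition only involves `dx`.
  have key (x y : ℕ) (q : ℤ) (h : (y : ℤ) + q = l) : T.dx x y q (r x y q) = 0 := by
    have e := congrFun (congrFun (congrFun hdr (x + 1)) y) q
    have e1 : dZ r (x + 1) y q = 0 := by simp [dZ, hl (x + 1) y (q - 1) (by lia)]
    have e2 : dY r (x + 1) y q = 0 := by
      rcases y with _ | y
      · rfl
      · simp only [dY]
        rw [hl (x + 1) y q (by push_cast at h; lia), map_zero]
    rw [d_apply, e1, e2, add_zero, add_zero] at e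
    exact e
  -- The preimage is taken to be zero wherever `r` vanishes, so that `z` inherits both the bound in
  -- `q` and the support condition.
  have hx (x y : ℕ) (q : ℤ) : ∃ z : T.X x y q, (r (x + 1) y q = 0 → z = 0) ∧
      ((y : ℤ) + q = l → T.dx x y q z = r (x + 1) y q) ∧ ((y : ℤ) + q ≠ l → z = 0) := by
    by_cases h : r (x + 1) y q = 0 ∨ (y : ℤ) + q ≠ l
    · rcases h with h | h
      · exact ⟨0, fun _ => rfl, fun _ => by rw [h, map_zero], fun _ => rfl⟩
      · exact ⟨0, fun _ => rfl, fun h' => absurd h' h, fun _ => rfl⟩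
    · push Not at h
      rcases y with _ | y
      · exact absurd (hr.2 _ _ _ fun h' => absurd h'.2 (lt_irrefl 0)) h.1
      · obtain ⟨z, hz⟩ := (hT.exact x y q _).1 (key (x + 1) (y + 1) q h.2)
        exact ⟨z, fun h' => absurd h' h.1, fun _ => hz, fun h' => absurd h.2 h'⟩
  choose z hz0 hz1 hz2 using hx
  obtain ⟨⟨b, hb⟩, hr'⟩ := hr
  refine ⟨z, ⟨⟨b, fun x y q hq => hz0 _ _ _ (hb _ _ _ hq)⟩,
    fun x y q h => hz0 _ _ _ (hr' _ _ _ fun h' => h ⟨by have := h'.1; push_cast at this; lia, h'.2⟩)⟩, fun x y q h => ?_⟩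
  · have e1 : dZ z x y q = 0 := by
      simp only [dZ]
      rw [hz2 x y (q - 1) (by lia), map_zero]
    have e2 : dY z x y q = 0 := by
      rcases y with _ | y
      · rfl
      · simp only [dY]
        rw [hz2 x y q (by push_cast at h; lia), map_zero]
    change r x y q - T.d z x y q = 0
    rw [d_apply, e1, e2, add_zero, add_zero]
    rcases x with _ | x
    · have e3 : r 0 y q = 0 := by
        rcases y with _ | y
        · exact hr' _ _ _ fun h' => absurd h'.2 (lt_irrefl 0)
        · by_cases hlt : ((y + 1 : ℕ) : ℤ) + q = l
          · exact hT.injective y q (by rw [key _ _ _ hlt, map_zero])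
          · exact hl _ _ _ (by lia)
      simp [dX, e3]
    · simp only [dX]
      by_cases hlt : (y : ℤ) + q = l
      · rw [hz1 _ _ _ hlt, sub_self]
      · rw [hz2 _ _ _ hlt, hl _ _ _ (by lia), map_zero, sub_zero]

/-- The cocycle is removed level by level in `y + q`. The bound on `q` supplies a lowest level, the
inequality `x ≥ 0` a highest one, so finitely many steps suffice. -/
lemma RowsExact.exists_d_eq (hT : T.RowsExact) {n : ℤ} {w : T.Fam}
    (hw : w ∈ T.cochains (fun _ y => 0 < y) n) (hdw : T.d w = 0) :
    ∃ z ∈ T.cochains (fun _ y => 0 < y) (n - 1), T.d z = w := by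
  obtain ⟨b, hb⟩ := hw.1
  have H (m : ℕ) : ∃ z ∈ T.cochains (fun _ y => 0 < y) (n - 1),
      ∀ (x y : ℕ) (q : ℤ), (y : ℤ) + q < b + m → (w - T.d z) x y q = 0 := by
    induction m with
    | zero =>
      refine ⟨0, zero_mem _, fun x y q h => ?_⟩
      rw [map_zero, sub_zero]
      exact hb x y q (by push_cast at h; lia)
    | succ m ih =>
      obtain ⟨z, hz, hzw⟩ := ih
      have hdz := d_mem_cochains (T := T) (S := fun _ y => 0 < y) (fun _ _ h => h)
        (fun _ _ h => Nat.succ_pos _) (by lia : n - 1 + 1 = n) hz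
      obtain ⟨z', hz', hzw'⟩ := hT.exists_step (sub_mem hw hdz)
        (by rw [map_sub, hdw, T.d_d, sub_zero]) hzw
      refine ⟨z + z', add_mem hz hz', fun x y q h => ?_⟩
      rw [map_add, ← sub_sub]
      exact hzw' x y q (by push_cast at h; lia)
  -- A point of total degree `n` has `x + y + q = n + 1`, hence `y + q < n + 2`.
  obtain ⟨z, hz, hzw⟩ := H (n + 2 - b).toNat
  refine ⟨z, hz, ?_⟩
  have hdz := d_mem_cochains (T := T) (S := fun _ y => 0 < y) (fun _ _ h => h)
    (fun _ _ h => Nat.succ_pos _) (by lia : n - 1 + 1 = n) hz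
  rw [eq_comm, ← sub_eq_zero]
  funext x y q
  by_cases h : (x : ℤ) + y + q = n + 1
  · exact hzw x y q (by lia)
  · exact (sub_mem hw hdz).2 x y q fun h' => h h'.1

/-- The support condition excluding the corner. -/
def offCorner (x y : ℕ) : Prop := 0 < x ∨ 0 < y

/-- The support condition of the bottom row without the corner. -/
def bottom (x y : ℕ) : Prop := 0 < x ∧ y = 0

lemma d_mem_offCorner {n m : ℤ} (hm : n + 1 = m) {w : T.Fam}
    (hw : w ∈ T.cochains offCorner n) : T.d w ∈ T.cochains offCorner m :=
  d_mem_cochains (fun _ _ _ => Or.inl (Nat.succ_pos _)) (fun _ _ _ => Or.inr (Nat.succ_pos _)) hm hw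

lemma bottom_offCorner {n : ℤ} {w : T.Fam} (hw : w ∈ T.cochains bottom n) :
    w ∈ T.cochains offCorner n :=
  cochains_mono (fun _ _ h => Or.inl h.1) hw

lemma mem_positive_of_bottom_eq_zero {n : ℤ} {w : T.Fam} (hw : w ∈ T.cochains offCorner n)
    (h : ∀ (x : ℕ) (q : ℤ), w x 0 q = 0) : w ∈ T.cochains (fun _ y => 0 < y) n := by
  refine ⟨hw.1, fun x y q h' => ?_⟩
  rcases y with _ | y
  · exact h x q
  · exact hw.2 x (y + 1) q fun h'' => h' ⟨h''.1, Nat.succ_pos _⟩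

/-- Cocycles of the bottom row extend to cocycles of the triple complex. -/
lemma RowsExact.exists_extension (hT : T.RowsExact) {n : ℤ} {v : T.Fam}
    (hv : v ∈ T.cochains bottom n) (hdv : ∀ (x : ℕ) (q : ℤ), T.d v x 0 q = 0) :
    ∃ w ∈ T.cochains offCorner n, T.d w = 0 ∧ ∀ (x : ℕ) (q : ℤ), w x 0 q = v x 0 q := by
  have hv' := bottom_offCorner hv
  -- The defect `T.d v` is a cocycle supported in the exact rows, so it is the differential of a
  -- family that does not meet the bottom row.
  obtain ⟨z, hz, hzv⟩ := hT.exists_d_eq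
    (mem_positive_of_bottom_eq_zero (d_mem_offCorner rfl hv') hdv) (T.d_d v)
  rw [add_sub_cancel_right] at hz
  refine ⟨v - z, sub_mem hv' (cochains_mono (fun _ _ h => Or.inr h) hz), ?_, fun x q => ?_⟩
  · rw [map_sub, hzv, sub_self]
  · change v x 0 q - z x 0 q = _
    rw [hz.2 x 0 q fun h => absurd h.2 (lt_irrefl 0), sub_zero]

/-- A cocycle of the triple complex is a coboundary if its restriction to the bottom row is. -/
lemma RowsExact.exists_d_eq_of_bottom (hT : T.RowsExact) {n : ℤ} {w e : T.Fam}
    (hw : w ∈ T.cochains offCorner n) (hdw : T.d w = 0)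
    (he : e ∈ T.cochains bottom (n - 1)) (h : ∀ (x : ℕ) (q : ℤ), w x 0 q = T.d e x 0 q) :
    ∃ z ∈ T.cochains offCorner (n - 1), T.d z = w := by
  have he' := bottom_offCorner he
  obtain ⟨z, hz, hzv⟩ := hT.exists_d_eq (w := w - T.d e)
    (mem_positive_of_bottom_eq_zero (sub_mem hw (d_mem_offCorner (by lia) he'))
      fun x q => by
        change w x 0 q - T.d e x 0 q = 0
        rw [h, sub_self])
    (by rw [map_sub, hdw, T.d_d, sub_zero])
  refine ⟨e + z, add_mem he' (cochains_mono (fun _ _ h => Or.inr h) hz), ?_⟩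
  rw [map_add, hzv, add_sub_cancel]

/-! ### Exchanging the first two directions -/

variable (T) in
/-- The triple complex with the first two directions exchanged. -/
def swap : TripleComplex R where
  X x y q := T.X y x q
  dx x y q := T.dy y x q
  dy x y q := T.dx y x q
  dz x y q := T.dz y x q
  dx_dx x y q := T.dy_dy y x q
  dy_dy x y q := T.dx_dx y x q
  dz_dz x y q := T.dz_dz y x q
  dx_dy x y q m := by rw [T.dx_dy, neg_neg]
  dx_dz x y q := T.dy_dz y x q
  dy_dz x y q := T.dx_dz y x q

/-- The family with the first two directions exchanged. -/
def Fam.swap (w : T.Fam) : T.swap.Fam := fun x y q => w y x q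

lemma d_swap (w : T.Fam) : T.swap.d w.swap = (T.d w).swap := by
  funext x y q
  have e1 : dX (T := T.swap) w.swap x y q = dY w y x q := by rcases x with _ | x <;> rfl
  have e2 : dY (T := T.swap) w.swap x y q = dX w y x q := by rcases y with _ | y <;> rfl
  have e3 : dZ (T := T.swap) w.swap x y q = dZ w y x q := rfl
  rw [d_apply, e1, e2, e3]
  exact congrArg (· + dZ w y x q) (add_comm (dY w y x q) (dX w y x q))

lemma swap_mem {S : ℕ → ℕ → Prop} {n : ℤ} {w : T.Fam} (hw : w ∈ T.cochains S n) :
    w.swap ∈ T.swap.cochains (fun x y => S y x) n :=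
  ⟨hw.1.imp fun _ hb x y q => hb y x q, fun x y q h => hw.2 y x q fun h' => h ⟨by lia, h'.2⟩⟩

/-- Cocycles of the first column extend to cocycles of the triple complex. -/
lemma exists_extension_of_left (hT : T.swap.RowsExact) {n : ℤ} {v : T.Fam}
    (hv : v ∈ T.cochains (fun x y => bottom y x) n) (hdv : ∀ y q, T.d v 0 y q = 0) :
    ∃ w ∈ T.cochains offCorner n, T.d w = 0 ∧ ∀ y q, w 0 y q = v 0 y q := by
  obtain ⟨w, hw, hdw, h⟩ := hT.exists_extension (swap_mem hv) fun x q => by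
    rw [d_swap]
    exact hdv x q
  exact ⟨fun x y q => w y x q, cochains_mono (fun _ _ => Or.symm) (swap_mem hw),
    (d_swap w).trans (congrArg Fam.swap hdw), h⟩

/-- A cocycle of the triple complex is a coboundary if its restriction to the first column is. -/
lemma exists_d_eq_of_left (hT : T.swap.RowsExact) {n : ℤ} {w e : T.Fam}
    (hw : w ∈ T.cochains offCorner n) (hdw : T.d w = 0)
    (he : e ∈ T.cochains (fun x y => bottom y x) (n - 1)) (h : ∀ y q, w 0 y q = T.d e 0 y q) :
    ∃ z ∈ T.cochains offCorner (n - 1), T.d z = w := by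
  obtain ⟨z, hz, hdz⟩ := hT.exists_d_eq_of_bottom
    (cochains_mono (fun _ _ => Or.symm) (swap_mem hw)) (by rw [d_swap, hdw]; rfl)
    (swap_mem he) fun x q => by
      rw [d_swap]
      exact h x q
  exact ⟨fun x y q => z y x q, cochains_mono (fun _ _ => Or.symm) (swap_mem hz),
    (d_swap z).trans (congrArg Fam.swap hdz)⟩

end TripleComplex

/-! ## Injective, projective and flat modules -/

section Modules

variable {R : Type u} [CommRing R]

/-- The map `f` factors through the image of `g`, and the factor extends from that image to `N`. -/
lemma Module.Injective.exists_comp_eq {M N J : Type u} [AddCommGroup M] [Module R M]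
    [AddCommGroup N] [Module R N] [AddCommGroup J] [Module R J] [Module.Injective R J]
    (g : M →ₗ[R] N) (f : M →ₗ[R] J) (h : LinearMap.ker g ≤ LinearMap.ker f) :
    ∃ e : N →ₗ[R] J, e ∘ₗ g = f := by
  obtain ⟨e, he⟩ := Module.Injective.extension_property R J _ _
    ((LinearMap.ker g).liftQ g le_rfl)
    (LinearMap.ker_eq_bot.1 (Submodule.ker_liftQ_eq_bot _ _ _ le_rfl))
    ((LinearMap.ker g).liftQ f h)
  refine ⟨e, LinearMap.ext fun x => ?_⟩
  exact LinearMap.congr_fun he (Submodule.Quotient.mk x)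

lemma Module.Projective.exists_comp_eq {P M N : Type u} [AddCommGroup M] [Module R M]
    [AddCommGroup N] [Module R N] [AddCommGroup P] [Module R P] [Module.Projective R P]
    (g : M →ₗ[R] N) (f : P →ₗ[R] N) (h : LinearMap.range f ≤ LinearMap.range g) :
    ∃ e : P →ₗ[R] M, g ∘ₗ e = f := by
  obtain ⟨e, he⟩ := Module.projective_lifting_property g.rangeRestrict
    (f.codRestrict (LinearMap.range g) fun x => h ⟨x, rfl⟩) g.surjective_rangeRestrict
  refine ⟨e, LinearMap.ext fun x => ?_⟩
  exact congrArg Subtype.val (LinearMap.congr_fun he x)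

lemma Module.Injective.of_retract {Q J : Type u} [AddCommGroup Q] [Module R Q]
    [AddCommGroup J] [Module R J] [Module.Injective R J] (i : Q →ₗ[R] J) (r : J →ₗ[R] Q)
    (h : r ∘ₗ i = LinearMap.id) : Module.Injective R Q where
  out X Y _ _ _ _ f hf g := by
    obtain ⟨e, he⟩ := Module.Injective.extension_property R J _ _ f hf (i ∘ₗ g)
    refine ⟨r ∘ₗ e, fun x => ?_⟩
    have h1 : e (f x) = i (g x) := LinearMap.congr_fun he x
    have h2 : r (i (g x)) = g x := LinearMap.congr_fun h (g x)
    rw [LinearMap.comp_apply, h1, h2]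

/-- The union of the supports of the images of finitely many generators works. -/
lemma LinearMap.exists_finset_support {M J ι : Type*} [AddCommGroup M] [Module R M]
    [Module.Finite R M] [AddCommGroup J] [Module R J] (g : M →ₗ[R] ι →₀ J) :
    ∃ T : Finset ι, ∀ i ∉ T, ∀ x, g x i = 0 := by
  classical
  obtain ⟨t, ht⟩ := Module.Finite.fg_top (R := R) (M := M)
  refine ⟨t.biUnion fun x => (g x).support, fun i hi x => ?_⟩
  have hle : (⊤ : Submodule R M) ≤ LinearMap.ker (Finsupp.lapply (R := R) i ∘ₗ g) := by
    rw [← ht, Submodule.span_le]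
    intro y hy
    by_contra hne
    exact hi (Finset.mem_biUnion.2 ⟨y, hy, Finsupp.mem_support_iff.2 hne⟩)
  exact hle (Submodule.mem_top (x := x))

/-- Direct sums of copies of an injective module over a noetherian ring are injective. -/
lemma Module.Injective.finsupp [IsNoetherianRing R] {J : Type u} [AddCommGroup J] [Module R J]
    [Module.Injective R J] (ι : Type u) : Module.Injective R (ι →₀ J) := by
  classical
  -- By Baer's criterion only maps from ideals need extending. Ideals are finitely generated, so
  -- such a map meets finitely many summands and extends summand by summand.
  refine Module.Baer.injective fun I g => ?_
  obtain ⟨T, hT⟩ := g.exists_finset_support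
  choose e he using fun i => Module.Injective.extension_property R J I R I.subtype
    Subtype.val_injective (Finsupp.lapply (R := R) i ∘ₗ g)
  refine ⟨∑ i ∈ T, Finsupp.lsingle i ∘ₗ e i, fun x hx => ?_⟩
  ext i
  have hei : e i x = g ⟨x, hx⟩ i := LinearMap.congr_fun (he i) ⟨x, hx⟩
  simp only [LinearMap.sum_apply, LinearMap.comp_apply, Finsupp.lsingle_apply,
    Finsupp.finsetSum_apply, Finsupp.single_apply, Finset.sum_ite_eq']
  split_ifs with h
  · exact hei
  · exact (hT i h _).symm

/-- Over a noetherian ring, the tensor product of an injective and a projective module is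
injective. -/
lemma Module.Injective.tensorProduct [IsNoetherianRing R] (J P : Type u) [AddCommGroup J]
    [Module R J] [Module.Injective R J] [AddCommGroup P] [Module R P] [Module.Projective R P] :
    Module.Injective R (J ⊗[R] P) := by
  obtain ⟨s, hs⟩ := Module.projective_def'.1 (inferInstance : Module.Projective R P)
  have : Module.Injective R (P →₀ J) := Module.Injective.finsupp P
  classical
  let e := TensorProduct.finsuppScalarRight R R J P
  -- A splitting of the free cover of `P` makes `J ⊗ P` a retract of a direct sum of copies of `J`.
  refine Module.Injective.of_retract (J := P →₀ J) (e.toLinearMap ∘ₗ s.lTensor J)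
    ((Finsupp.linearCombination R id).lTensor J ∘ₗ e.symm.toLinearMap) ?_
  refine LinearMap.ext fun x => ?_
  simp only [LinearMap.comp_apply, LinearEquiv.coe_coe, LinearEquiv.symm_apply_apply]
  rw [← LinearMap.comp_apply, ← LinearMap.lTensor_comp, hs, LinearMap.lTensor_id]

end Modules

/-! ## The triple complex `Hom(A, B ⊗ C)` -/

namespace BoundedCohomology

variable {R : Type u} [CommRing R] (A : ChainComplex (ModuleCat.{u} R) ℕ)
  (B : CochainComplex (ModuleCat.{u} R) ℕ) (C : CochainComplex (ModuleCat.{u} R) ℤ)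

lemma hom_d_d {ι : Type*} {c : ComplexShape ι} (K : HomologicalComplex (ModuleCat.{u} R) c)
    (i j l : ι) (x : K.X i) : (K.d j l).hom ((K.d i j).hom x) = 0 :=
  LinearMap.congr_fun (congrArg ModuleCat.Hom.hom (K.d_comp_d i j l)) x

lemma rTensor_lTensor_comm {M N P Q : Type*} [AddCommGroup M] [Module R M] [AddCommGroup N]
    [Module R N] [AddCommGroup P] [Module R P] [AddCommGroup Q] [Module R Q]
    (f : M →ₗ[R] N) (g : P →ₗ[R] Q) (x : M ⊗[R] P) :
    f.rTensor Q (g.lTensor M x) = g.lTensor N (f.rTensor P x) := by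
  rw [← LinearMap.comp_apply, ← LinearMap.comp_apply, LinearMap.lTensor_comp_rTensor,
    LinearMap.rTensor_comp_lTensor]

/-- The triple complex with terms `Hom(A_x, B_y ⊗ C_q)`. -/
noncomputable def homTensor : TripleComplex R where
  X x y q := ModuleCat.of R (A.X x →ₗ[R] B.X y ⊗[R] C.X q)
  -- This sign makes `dx` anticommute with the other two differentials. On the bottom row it is also
  -- the sign of the differential of the Hom complex.
  dx x y q := (((x : ℤ) + y + q).negOnePow : ℤ) • LinearMap.lcomp R _ (A.d (x + 1) x).hom
  dy x y q := LinearMap.compRight R ((B.d y (y + 1)).hom.rTensor (C.X q))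
  dz x y q := ((y : ℤ).negOnePow : ℤ) •
    LinearMap.compRight R ((C.d (q - 1) q).hom.lTensor (B.X y))
  dx_dx x y q m := by
    refine LinearMap.ext fun a => ?_
    simp [hom_d_d A]
  dy_dy x y q m := by
    refine LinearMap.ext fun a => ?_
    simp only [LinearMap.compRight_apply, LinearMap.comp_apply]
    rw [← LinearMap.comp_apply, ← LinearMap.rTensor_comp,
      show (B.d (y + 1) (y + 1 + 1)).hom ∘ₗ (B.d y (y + 1)).hom = 0 from
        LinearMap.ext (hom_d_d B _ _ _)]
    simp
  dz_dz x y q m := by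
    refine LinearMap.ext fun a => ?_
    simp only [LinearMap.smul_apply, LinearMap.compRight_apply, map_zsmul, LinearMap.comp_apply]
    rw [← LinearMap.comp_apply (LinearMap.lTensor _ _), ← LinearMap.lTensor_comp,
      show (C.d (q - 1) q).hom ∘ₗ (C.d (q - 1 - 1) (q - 1)).hom = 0 from
        LinearMap.ext (hom_d_d C _ _ _)]
    simp
  dx_dy x y q m := by
    refine LinearMap.ext fun a => ?_
    have : (x : ℤ) + (y + 1 : ℕ) + q = x + y + q + 1 := by push_cast; ring
    rw [this, Int.negOnePow_succ]
    simp
  dx_dz x y q m := by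
    refine LinearMap.ext fun a => ?_
    have : (x : ℤ) + y + q = (x + y + (q - 1)) + 1 := by ring
    rw [this, Int.negOnePow_succ]
    simp only [LinearMap.smul_apply, LinearMap.compRight_apply, map_zsmul, LinearMap.comp_apply,
      LinearMap.neg_apply, Units.val_neg, neg_smul, LinearMap.lcomp_apply]
    rw [smul_neg, smul_comm]
  dy_dz x y q m := by
    refine LinearMap.ext fun a => ?_
    have : ((y + 1 : ℕ) : ℤ).negOnePow = -((y : ℤ).negOnePow) := by
      rw [Nat.cast_succ, Int.negOnePow_succ]
    rw [this]
    simp only [LinearMap.smul_apply, LinearMap.compRight_apply, map_zsmul, LinearMap.comp_apply,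
      LinearMap.neg_apply, Units.val_neg, neg_smul, neg_neg]
    exact congrArg _ (rTensor_lTensor_comm _ _ (m a))

variable {A B C}

lemma negOnePow_smul_smul {M : Type*} [AddCommGroup M] (c : ℤ) (x : M) :
    (c.negOnePow : ℤ) • (c.negOnePow : ℤ) • x = x := by
  rw [smul_smul, ← Units.val_mul, Int.units_mul_self, Units.val_one, one_smul]

lemma exact_zsmul_negOnePow {M N P : Type*} [AddCommGroup M] [AddCommGroup N] [AddCommGroup P]
    [Module R M] [Module R N] [Module R P] {f : M →ₗ[R] N} {g : N →ₗ[R] P}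
    (h : Function.Exact f g) (a b : ℤ) :
    Function.Exact ((a.negOnePow : ℤ) • f) ((b.negOnePow : ℤ) • g) := by
  intro y
  constructor
  · intro hy
    have hy' : g y = 0 := by
      rw [← negOnePow_smul_smul b (g y)]
      exact (congrArg _ hy).trans (smul_zero _)
    obtain ⟨x, rfl⟩ := (h y).1 hy'
    exact ⟨(a.negOnePow : ℤ) • x, by
      rw [LinearMap.smul_apply, map_zsmul, negOnePow_smul_smul]⟩
  · rintro ⟨x, rfl⟩
    rw [LinearMap.smul_apply, LinearMap.smul_apply, map_zsmul, h.apply_apply_eq_zero, smul_zero,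
      smul_zero]

/-- `Hom(-, J)` turns the exact complex `A` into an exact one when `J` is injective. -/
lemma homTensor_rowsExact (hA0 : Function.Surjective (A.d 1 0).hom)
    (hA : ∀ i, Function.Exact (A.d (i + 2) (i + 1)).hom (A.d (i + 1) i).hom)
    (hJ : ∀ y q, Module.Injective R (B.X (y + 1) ⊗[R] C.X q)) :
    (homTensor A B C).RowsExact where
  injective y q := by
    refine (injective_iff_map_eq_zero _).2 fun (f : A.X 0 →ₗ[R] B.X (y + 1) ⊗[R] C.X q) hf => ?_
    refine LinearMap.ext fun a => ?_
    obtain ⟨a, rfl⟩ := hA0 a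
    have h1 := LinearMap.congr_fun hf a
    have h2 : ((((0 : ℕ) : ℤ) + (y + 1 : ℕ) + q).negOnePow : ℤ) • f ((A.d 1 0).hom a) = 0 := h1
    rw [← Units.smul_def] at h2
    exact (smul_eq_zero_iff_eq _).1 h2
  exact x y q := by
    have := hJ y q
    refine exact_zsmul_negOnePow 
      (fun (f : A.X (x + 1) →ₗ[R] B.X (y + 1) ⊗[R] C.X q) => ⟨fun hf => ?_, ?_⟩) _ _
    · refine Module.Injective.exists_comp_eq (A.d (x + 1) x).hom f fun a ha => ?_
      obtain ⟨b, rfl⟩ := (hA x a).1 ha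
      exact LinearMap.congr_fun hf b
    · rintro ⟨f : A.X x →ₗ[R] B.X (y + 1) ⊗[R] C.X q, rfl⟩
      refine LinearMap.ext fun a => ?_
      change f _ = 0
      rw [hom_d_d, map_zero]

/-- Tensoring with the flat module `C_q` keeps `B` exact, and `Hom` out of a projective module
preserves exactness. -/
lemma homTensor_swap_rowsExact (hB0 : Function.Injective (B.d 0 1).hom)
    (hB : ∀ i, Function.Exact (B.d i (i + 1)).hom (B.d (i + 1) (i + 2)).hom)
    (hA : ∀ x, Module.Projective R (A.X (x + 1))) (hC : ∀ q, Module.Flat R (C.X q)) :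
    (homTensor A B C).swap.RowsExact where
  injective x q := by
    have := hC q
    refine (injective_iff_map_eq_zero _).2 fun (f : A.X (x + 1) →ₗ[R] B.X 0 ⊗[R] C.X q) hf => ?_
    refine LinearMap.ext fun a => ?_
    have h1 : (B.d 0 1).hom.rTensor (C.X q) (f a) = 0 := LinearMap.congr_fun hf a
    exact Module.Flat.rTensor_preserves_injective_linearMap _ hB0 (h1.trans (map_zero _).symm)
  exact y x q := by
    intro (f : A.X (x + 1) →ₗ[R] B.X (y + 1) ⊗[R] C.X q)
    have := hC q
    have := hA x
    have hex := Module.Flat.rTensor_exact (C.X q) (hB y)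
    constructor
    · intro hf
      refine Module.Projective.exists_comp_eq ((B.d y (y + 1)).hom.rTensor (C.X q)) f ?_
      rintro _ ⟨a, rfl⟩
      exact (hex _).1 (LinearMap.congr_fun hf a)
    · rintro ⟨f : A.X (x + 1) →ₗ[R] B.X y ⊗[R] C.X q, rfl⟩
      exact LinearMap.ext fun a => hex.apply_apply_eq_zero (f a)

end BoundedCohomology

/-! ### The action of `Hom(C, C)`, augmented resolutions and the bottom row -/

namespace BoundedCohomology

open TripleComplex

variable {R : Type u} [CommRing R]

/-- An element of a term of `homTensor A B C`, as a linear map. -/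
abbrev asHom {A : ChainComplex (ModuleCat.{u} R) ℕ} {B : CochainComplex (ModuleCat.{u} R) ℕ}
    {C : CochainComplex (ModuleCat.{u} R) ℤ} {x y : ℕ} {q : ℤ} (f : (homTensor A B C).X x y q) :
    A.X x →ₗ[R] B.X y ⊗[R] C.X q := f

section Action

variable (A : ChainComplex (ModuleCat.{u} R) ℕ)
  (B : CochainComplex (ModuleCat.{u} R) ℕ) {C : CochainComplex (ModuleCat.{u} R) ℤ}

/-- The action of a cochain of `Hom(C, C)` on the terms of the complex `Hom(A, B ⊗ C)`. -/
noncomputable def termAct {a : ℤ} (α : Cochain C C a) (x y : ℕ) (r q : ℤ) (h : r + a = q) :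
    (homTensor A B C).X x y r →ₗ[R] (homTensor A B C).X x y q :=
  -- The Koszul sign for moving `α` past `B_y`. It makes the action commute with all three
  -- differentials up to the same sign `(-1)^a`, and it is trivial on the bottom row.
  ((a * y).negOnePow : ℤ) • LinearMap.compRight R ((α.v r q h).hom.lTensor (B.X y))

/-- The action of a cochain of `Hom(C, C)` on families of homomorphisms from `A` to `B ⊗ C`. -/
noncomputable def famAct {a : ℤ} (α : Cochain C C a) :
    (homTensor A B C).Fam →ₗ[R] (homTensor A B C).Fam where
  toFun w := fun x y q => termAct A B α x y (q - a) q (by lia) (w x y (q - a))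
  map_add' v w := by
    funext x y q
    exact map_add _ _ _
  map_smul' r w := by
    funext x y q
    exact (termAct A B α x y (q - a) q (by lia)).map_smul r _

variable {A B}

lemma famAct_apply {a : ℤ} (α : Cochain C C a) (w : (homTensor A B C).Fam) (x y : ℕ) (q r : ℤ)
    (h : r + a = q) : famAct A B α w x y q = termAct A B α x y r q h (w x y r) := by
  obtain rfl : r = q - a := by lia
  rfl

lemma famAct_mem {a n m : ℤ} (h : n + a = m) (α : Cochain C C a) {S : ℕ → ℕ → Prop}
    {w : (homTensor A B C).Fam} (hw : w ∈ (homTensor A B C).cochains S n) :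
    famAct A B α w ∈ (homTensor A B C).cochains S m := by
  obtain ⟨⟨b, hb⟩, hw⟩ := hw
  refine ⟨⟨b + a, fun x y q hq => ?_⟩, fun x y q hq => ?_⟩
  · rw [famAct_apply α w x y q (q - a) (by lia), hb x y (q - a) (by lia), map_zero]
  · rw [famAct_apply α w x y q (q - a) (by lia), hw x y (q - a) fun h' => hq ⟨by lia, h'.2⟩,
      map_zero]

lemma cocycle_comm {a : ℤ} (α : Cocycle C C a) (p q p' q' : ℤ)
    (h : p + a = q) (hp : p + 1 = p') (hq : q + 1 = q') :
    (C.d q q').hom ∘ₗ (α.1.v p q h).hom =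
      (a.negOnePow : ℤ) • (α.1.v p' q' (by lia)).hom ∘ₗ (C.d p p').hom := by
  refine LinearMap.ext fun c => ?_
  have e := δ_v_apply (rfl : a + 1 = a + 1) α.1 p q' p' q (by lia) h hp c
  rw [Cocycle.δ_eq_zero, Int.negOnePow_succ] at e
  have e' := (eq_neg_of_add_eq_zero_left e.symm)
  simpa only [Units.val_neg, neg_smul, neg_neg] using! e'

lemma cocycle_lTensor_comm {a : ℤ} (α : Cocycle C C a) (M : Type u) [AddCommGroup M] [Module R M]
    (p q p' q' : ℤ) (h : p + a = q) (hp : p + 1 = p') (hq : q + 1 = q') (t : M ⊗[R] C.X p) :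
    (C.d q q').hom.lTensor M ((α.1.v p q h).hom.lTensor M t) =
      (a.negOnePow : ℤ) •
        (α.1.v p' q' (by lia)).hom.lTensor M ((C.d p p').hom.lTensor M t) := by
  rw [← LinearMap.lTensor_comp_apply, ← LinearMap.lTensor_comp_apply,
    cocycle_comm α p q p' q' h hp hq]
  exact LinearMap.congr_fun (map_zsmul (LinearMap.lTensorHom (R := R) M) _ _) t

lemma dx_termAct {a : ℤ} (α : Cochain C C a) (x y : ℕ) (r q : ℤ) (h : r + a = q)
    (f : (homTensor A B C).X x y r) :
    (homTensor A B C).dx x y q (termAct A B α x y r q h f) =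
      (a.negOnePow : ℤ) • termAct A B α (x + 1) y r q h ((homTensor A B C).dx x y r f) := by
  subst h
  refine LinearMap.ext fun t => ?_
  let g := (α.v r (r + a) rfl).hom.lTensor (B.X y)
  let s := asHom f ((A.d (x + 1) x).hom t)
  change (((x : ℤ) + y + (r + a)).negOnePow : ℤ) • ((a * y).negOnePow : ℤ) • g s =
    (a.negOnePow : ℤ) • ((a * y).negOnePow : ℤ) • g ((((x : ℤ) + y + r).negOnePow : ℤ) • s)
  rw [map_zsmul, ← add_assoc, Int.negOnePow_add _ a, Units.val_mul, mul_comm, mul_smul,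
    smul_comm (((x : ℤ) + y + r).negOnePow : ℤ)]

lemma dy_termAct {a : ℤ} (α : Cochain C C a) (x y : ℕ) (r q : ℤ) (h : r + a = q)
    (f : (homTensor A B C).X x y r) :
    (homTensor A B C).dy x y q (termAct A B α x y r q h f) =
      (a.negOnePow : ℤ) • termAct A B α x (y + 1) r q h ((homTensor A B C).dy x y r f) := by
  refine LinearMap.ext fun t => ?_
  let g (y) := (α.v r q h).hom.lTensor (B.X y)
  let s := asHom f t
  change (B.d y (y + 1)).hom.rTensor _ (((a * y).negOnePow : ℤ) • g y s) =
    (a.negOnePow : ℤ) • ((a * (y + 1 : ℕ)).negOnePow : ℤ) •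
      g (y + 1) ((B.d y (y + 1)).hom.rTensor _ s)
  have hs : (a * (y + 1 : ℕ)).negOnePow = a.negOnePow * (a * y).negOnePow := by
    rw [← Int.negOnePow_add, Nat.cast_succ, mul_add, mul_one, add_comm]
  rw [map_zsmul, rTensor_lTensor_comm, hs, Units.val_mul, mul_smul, negOnePow_smul_smul]

lemma dz_termAct {a : ℤ} (α : Cocycle C C a) (x y : ℕ) (r q : ℤ) (h : r + a = q)
    (h' : r - 1 + a = q - 1) (f : (homTensor A B C).X x y (r - 1)) :
    (homTensor A B C).dz x y q (termAct A B α.1 x y (r - 1) (q - 1) h' f) =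
      (a.negOnePow : ℤ) • termAct A B α.1 x y r q h ((homTensor A B C).dz x y r f) := by
  refine LinearMap.ext fun t => ?_
  let s := asHom f t
  change ((y : ℤ).negOnePow : ℤ) • (C.d (q - 1) q).hom.lTensor _
      (((a * y).negOnePow : ℤ) • (α.1.v (r - 1) (q - 1) h').hom.lTensor (B.X y) s) =
    (a.negOnePow : ℤ) • ((a * y).negOnePow : ℤ) • (α.1.v r q h).hom.lTensor (B.X y)
      (((y : ℤ).negOnePow : ℤ) • (C.d (r - 1) r).hom.lTensor _ s)
  have e := cocycle_lTensor_comm α (B.X y) (r - 1) (q - 1) r q h' (by lia) (by lia) s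
  rw [map_zsmul, map_zsmul, e, smul_comm (a.negOnePow : ℤ) ((a * y).negOnePow : ℤ),
    smul_comm ((y : ℤ).negOnePow : ℤ), smul_comm ((y : ℤ).negOnePow : ℤ)]

/-- The sign `(-1)^a` has a different source in each direction: for `dx` the shift of `q` in its
sign, for `dy` the factor `(-1)^(a y)` in the action, for `dz` the cocycle condition on `α`. -/
lemma d_famAct {a : ℤ} (α : Cocycle C C a) (w : (homTensor A B C).Fam) :
    (homTensor A B C).d (famAct A B α.1 w) =
      (a.negOnePow : ℤ) • famAct A B α.1 ((homTensor A B C).d w) := by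
  funext x y q
  have h : q - a + a = q := by lia
  have hx : dX (famAct A B α.1 w) x y q =
      (a.negOnePow : ℤ) • termAct A B α.1 x y (q - a) q h (dX w x y (q - a)) := by
    rcases x with _ | x
    · exact ((congrArg _ (map_zero _)).trans (smul_zero _)).symm
    · exact dx_termAct α.1 x y (q - a) q h _
  have hy : dY (famAct A B α.1 w) x y q =
      (a.negOnePow : ℤ) • termAct A B α.1 x y (q - a) q h (dY w x y (q - a)) := by
    rcases y with _ | y
    · exact ((congrArg _ (map_zero _)).trans (smul_zero _)).symm
    · exact dy_termAct α.1 x y (q - a) q h _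
  have hz : dZ (famAct A B α.1 w) x y q =
      (a.negOnePow : ℤ) • termAct A B α.1 x y (q - a) q h (dZ w x y (q - a)) := by
    have h' : q - a - 1 + a = q - 1 := by lia
    refine Eq.trans ?_ (dz_termAct α x y (q - a) q h h' _)
    exact congrArg _ (famAct_apply α.1 w x y (q - 1) (q - a - 1) h')
  change _ = (a.negOnePow : ℤ) • termAct A B α.1 x y (q - a) q h (TripleComplex.d _ w x y (q - a))
  rw [d_apply, d_apply, hx, hy, hz, map_add, map_add, smul_add, smul_add]

end Action

variable {R : Type u} [CommRing R]

lemma lid_lTensor {M N : Type*} [AddCommGroup M] [Module R M] [AddCommGroup N] [Module R N]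
    (f : M →ₗ[R] N) (t : R ⊗[R] M) :
    TensorProduct.lid R N (f.lTensor R t) = f (TensorProduct.lid R M t) := by
  induction t with
  | zero => simp
  | add s t hs ht => simp only [map_add, hs, ht]
  | tmul r m => simp

/-! ### Augmented resolutions -/

/-- A projective resolution with the resolved module added in degree `0`. -/
noncomputable def augmentedProj {M : ModuleCat.{u} R} (F : ProjectiveResolution M) :
    ChainComplex (ModuleCat.{u} R) ℕ :=
  F.complex.augment (X := M) (F.π.f 0) F.complex_d_comp_π_f_zero

/-- An injective resolution with the resolved module added in degree `0`. -/
noncomputable def augmentedInj {M : ModuleCat.{u} R} (I : InjectiveResolution M) :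
    CochainComplex (ModuleCat.{u} R) ℕ :=
  I.cocomplex.augment (X := M) (I.ι.f 0) I.ι_f_zero_comp_complex_d

lemma augmentedProj_surjective {M : ModuleCat.{u} R} (F : ProjectiveResolution M) :
    Function.Surjective ((augmentedProj F).d 1 0).hom :=
  (ModuleCat.epi_iff_surjective (F.π.f 0)).1 inferInstance

lemma augmentedProj_exact {M : ModuleCat.{u} R} (F : ProjectiveResolution M) (i : ℕ) :
    Function.Exact ((augmentedProj F).d (i + 2) (i + 1)).hom
      ((augmentedProj F).d (i + 1) i).hom := by
  rcases i with _ | i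
  · exact (ShortComplex.ShortExact.moduleCat_exact_iff_function_exact _).1 F.exact₀
  · exact (ShortComplex.ShortExact.moduleCat_exact_iff_function_exact _).1 (F.exact_succ i)

lemma augmentedInj_injective {M : ModuleCat.{u} R} (I : InjectiveResolution M) :
    Function.Injective ((augmentedInj I).d 0 1).hom :=
  (ModuleCat.mono_iff_injective (I.ι.f 0)).1 inferInstance

lemma augmentedInj_exact {M : ModuleCat.{u} R} (I : InjectiveResolution M) (i : ℕ) :
    Function.Exact ((augmentedInj I).d i (i + 1)).hom
      ((augmentedInj I).d (i + 1) (i + 2)).hom := by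
  rcases i with _ | i
  · exact (ShortComplex.ShortExact.moduleCat_exact_iff_function_exact _).1 I.exact₀
  · exact (ShortComplex.ShortExact.moduleCat_exact_iff_function_exact _).1 (I.exact_succ i)

lemma projective_cochainComplex {N : ModuleCat.{u} R} (G : ProjectiveResolution N) (q : ℤ) :
    Module.Projective R (G.cochainComplex.X q) :=
  have : Projective (G.cochainComplex.X q) := inferInstance
  (IsProjective.iff_projective (R := R) (G.cochainComplex.X q)).2 this

section Resolutions

variable {M N : ModuleCat.{u} R} (F : ProjectiveResolution M)
  (I : InjectiveResolution (ModuleCat.of R R)) (C : CochainComplex (ModuleCat.{u} R) ℤ)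

/-- The triple complex with terms `Hom(F_{x-1}, I^{y-1} ⊗ C_q)` where `F_{-1} = M` and
`I^{-1} = R`. -/
noncomputable abbrev resolvedHom : TripleComplex R :=
  homTensor (augmentedProj F) (augmentedInj I) C

lemma resolvedHom_rowsExact [IsNoetherianRing R] (hC : ∀ q, Module.Projective R (C.X q)) :
    (resolvedHom F I C).RowsExact :=
  homTensor_rowsExact (augmentedProj_surjective F) (augmentedProj_exact F) fun y q => by
    have := hC q
    have h : Injective (I.cocomplex.X y) := I.injective y
    have h' : Module.Injective R (I.cocomplex.X y) :=
      (Module.injective_iff_injective_object R (I.cocomplex.X y)).2 h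
    exact @Module.Injective.tensorProduct R _ _ (I.cocomplex.X y) (C.X q) _ _ h' _ _ _

lemma resolvedHom_swap_rowsExact (hC : ∀ q, Module.Projective R (C.X q)) :
    (resolvedHom F I C).swap.RowsExact :=
  homTensor_swap_rowsExact (augmentedInj_injective I) (augmentedInj_exact I)
    (fun x => (IsProjective.iff_projective (R := R) (F.complex.X x)).2 (F.projective x))
    fun q => by
      have := hC q
      infer_instance

/-! ### The bottom row -/

variable {F I C}

/-- The component `F_i → R ⊗ C_q` of a family in the bottom row. -/
def bottomTerm (w : (resolvedHom F I C).Fam) (i : ℕ) (q : ℤ) :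
    F.complex.X i →ₗ[R] R ⊗[R] C.X q := w (i + 1) 0 q

/-- The homomorphism `F_i → C_q` given by a component of a family in the bottom row. -/
noncomputable def bottomHom (w : (resolvedHom F I C).Fam) (i : ℕ) (q : ℤ) :
    F.complex.X i →ₗ[R] C.X q :=
  (TensorProduct.lid R (C.X q)).toLinearMap ∘ₗ
    bottomTerm w i q

variable (F I C) in
/-- The cochain of `Hom(F, C)` given by the bottom row of a family. -/
noncomputable def bottomCochain (n : ℤ) :
    (resolvedHom F I C).Fam →ₗ[R] Cochain F.cochainComplex C n where
  toFun w := Cochain.mk fun p q _ => if h : p ≤ 0 then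
    (F.cochainComplexXIso p (-p).toNat).hom ≫ ModuleCat.ofHom (bottomHom w (-p).toNat q) else 0
  map_add' v w := by
    ext p q hpq : 3
    rw [Cochain.add_v]
    by_cases h : p ≤ 0
    · simp only [Cochain.mk_v, dif_pos h]
      rw [← Preadditive.comp_add]
      congr 1
      ext x
      exact map_add (TensorProduct.lid R (C.X q)) _ _
    · simp only [Cochain.mk_v, dif_neg h, add_zero]
  map_smul' r w := by
    ext p q hpq : 3
    rw [RingHom.id_apply, Cochain.smul_v]
    by_cases h : p ≤ 0
    · simp only [Cochain.mk_v, dif_pos h]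
      rw [← Linear.comp_smul]
      congr 1
      ext x
      exact map_smul (TensorProduct.lid R (C.X q)) _ _
    · simp only [Cochain.mk_v, dif_neg h, smul_zero]

lemma bottomCochain_v (n : ℤ) (w : (resolvedHom F I C).Fam) (i : ℕ) (p q : ℤ) (h : p + n = q)
    (hp : -(i : ℤ) = p) : (bottomCochain F I C n w).v p q h =
      (F.cochainComplexXIso p i).hom ≫ ModuleCat.ofHom (bottomHom w i q) := by
  obtain rfl : i = (-p).toNat := by lia
  exact dif_pos (by lia)

lemma bottomCochain_ext {n : ℤ} {β γ : Cochain F.cochainComplex C n}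
    (h : ∀ (i : ℕ) (q : ℤ) (hq : -(i : ℤ) + n = q), β.v (-i) q hq = γ.v (-i) q hq) : β = γ := by
  ext p q hpq : 1
  by_cases hp : p ≤ 0
  · obtain ⟨i, rfl⟩ := Int.exists_eq_neg_ofNat hp
    exact h i q hpq
  · exact (CochainComplex.isZero_of_isStrictlyLE F.cochainComplex 0 p (by lia)).eq_of_src _ _

lemma bottomCochain_congr {n : ℤ} {v w : (resolvedHom F I C).Fam}
    (h : ∀ x q, v x 0 q = w x 0 q) : bottomCochain F I C n v = bottomCochain F I C n w := by
  refine bottomCochain_ext fun i q hq => ?_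
  rw [bottomCochain_v n v i (-i) q hq rfl, bottomCochain_v n w i (-i) q hq rfl, bottomHom,
    bottomHom, bottomTerm, bottomTerm, h]

lemma bottomCochain_mem {S : ℕ → ℕ → Prop} {n : ℤ} {w : (resolvedHom F I C).Fam}
    (hw : w ∈ (resolvedHom F I C).cochains S n) :
    bottomCochain F I C n w ∈ boundedCochains F.cochainComplex C n := by
  obtain ⟨⟨b, hb⟩, -⟩ := hw
  -- Below `b - n` one has `q = p + n < b`; the `0` ensures that `p` is the degree of some `F_i`.
  refine ⟨min 0 (b - n), fun p q h hp => ?_⟩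
  obtain ⟨i, rfl⟩ := Int.exists_eq_neg_ofNat (show p ≤ 0 by lia)
  rw [bottomCochain_v n w i (-i) q h rfl]
  have : bottomHom w i q = 0 := by
    rw [bottomHom, bottomTerm, hb (i + 1) 0 q (by lia)]
    exact LinearMap.comp_zero _
  rw [this]
  exact Limits.comp_zero

/-- Away from the corner the bottom row is a copy of `Hom(F, C)`, because `R ⊗ C_q = C_q`; at the
corner the family vanishes by its support condition. -/
lemma eq_zero_of_bottomCochain_eq_zero {n : ℤ} {w : (resolvedHom F I C).Fam}
    (hw : w ∈ (resolvedHom F I C).cochains offCorner n) (h : bottomCochain F I C n w = 0)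
    (x : ℕ) (q : ℤ) : w x 0 q = 0 := by
  by_cases hx : (x : ℤ) + (0 : ℕ) + q = n + 1 ∧ offCorner x 0
  · rcases x with _ | i
    · exact absurd hx.2 (by simp [offCorner])
    · have e : (bottomCochain F I C n w).v (-i) q (by have := hx.1; push_cast at this; lia) = 0 := by
        rw [h, Cochain.zero_v]
      rw [bottomCochain_v n w i (-i) q _ rfl] at e
      have e1 : ModuleCat.ofHom (bottomHom w i q) = 0 := by
        rw [← cancel_epi (F.cochainComplexXIso (-i) i).hom, e, Limits.comp_zero]
      refine LinearMap.ext fun t => ?_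
      exact (TensorProduct.lid R (C.X q)).injective
        ((LinearMap.congr_fun (congrArg ModuleCat.Hom.hom e1) t).trans (map_zero _).symm)
  · exact hw.2 x 0 q hx

/-- Here the removal of the corner matters: a component in `Hom(k, R ⊗ C_q)` would contribute a term
through the augmentation of `F`, which the Hom complex does not have. -/
lemma bottomHom_d_zero {n : ℤ} {w : (resolvedHom F I C).Fam}
    (hw : w ∈ (resolvedHom F I C).cochains offCorner n) (q : ℤ) :
    bottomHom ((resolvedHom F I C).d w) 0 q = (C.d (q - 1) q).hom ∘ₗ bottomHom w 0 (q - 1) := by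
  refine LinearMap.ext fun t => ?_
  have h0 : w 0 0 q = 0 := hw.2 0 0 q fun h => by simp [offCorner] at h
  have e : (resolvedHom F I C).d w (0 + 1) 0 q = dZ w (0 + 1) 0 q := by
    rw [d_apply]
    simp only [dX, dY, h0, map_zero, add_zero, zero_add]
  rw [bottomHom, bottomTerm, e]
  change TensorProduct.lid R (C.X q) ((((0 : ℕ) : ℤ).negOnePow : ℤ) •
    (C.d (q - 1) q).hom.lTensor R (bottomTerm w 0 (q - 1) t)) =
      (C.d (q - 1) q).hom (TensorProduct.lid R (C.X (q - 1)) (bottomTerm w 0 (q - 1) t))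
  rw [Nat.cast_zero, Int.negOnePow_zero, Units.val_one, one_smul, lid_lTensor]

lemma bottomHom_d_succ (w : (resolvedHom F I C).Fam) (i : ℕ) (q : ℤ) :
    bottomHom ((resolvedHom F I C).d w) (i + 1) q =
      (C.d (q - 1) q).hom ∘ₗ bottomHom w (i + 1) (q - 1) +
        (((i : ℤ) + 1 + q).negOnePow : ℤ) • bottomHom w i q ∘ₗ (F.complex.d (i + 1) i).hom := by
  refine LinearMap.ext fun t => ?_
  change TensorProduct.lid R (C.X q) ((((((i + 1 : ℕ) : ℤ) + ((0 : ℕ) : ℤ) + q).negOnePow : ℤ) •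
    bottomTerm w i q ((F.complex.d (i + 1) i).hom t) + 0) +
    (((0 : ℕ) : ℤ).negOnePow : ℤ) •
    (C.d (q - 1) q).hom.lTensor R (bottomTerm w (i + 1) (q - 1) t)) =
      (C.d (q - 1) q).hom (TensorProduct.lid R (C.X (q - 1)) (bottomTerm w (i + 1) (q - 1) t)) +
      (((i : ℤ) + 1 + q).negOnePow : ℤ) •
        TensorProduct.lid R (C.X q) (bottomTerm w i q ((F.complex.d (i + 1) i).hom t))
  rw [Nat.cast_zero, Int.negOnePow_zero, Units.val_one, one_smul, add_zero, map_add, map_zsmul,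
    add_zero, Nat.cast_succ, ← lid_lTensor, add_comm]

lemma δ_bottomCochain {n m : ℤ} (hm : n + 1 = m) {w : (resolvedHom F I C).Fam}
    (hw : w ∈ (resolvedHom F I C).cochains offCorner n) :
    δ n m (bottomCochain F I C n w) = bottomCochain F I C m ((resolvedHom F I C).d w) := by
  refine bottomCochain_ext fun i q hq => ?_
  rw [bottomCochain_v m _ i (-i) q _ rfl,
    δ_v n m hm _ (-i) q hq (q - 1) (-i + 1) rfl rfl,
    bottomCochain_v n w i (-i) (q - 1) (by lia) rfl]
  rcases i with _ | i
  · rw [(CochainComplex.isZero_of_isStrictlyLE F.cochainComplex 0 (-((0 : ℕ) : ℤ) + 1)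
      (by simp)).eq_of_tgt (F.cochainComplex.d (-((0 : ℕ) : ℤ)) (-((0 : ℕ) : ℤ) + 1)) 0,
      Limits.zero_comp, smul_zero, add_zero, bottomHom_d_zero hw, Category.assoc]
    rfl
  · rw [bottomCochain_v n w i (-((i + 1 : ℕ) : ℤ) + 1) q (by lia) (by push_cast; lia),
      F.cochainComplex_d _ _ (i + 1) i rfl (by push_cast; lia), bottomHom_d_succ]
    have hs : m = (i : ℤ) + 1 + q := by
      push_cast at hq
      lia
    rw [hs, Units.smul_def]
    simp only [Category.assoc, Iso.inv_hom_id_assoc]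
    rw [← Preadditive.comp_zsmul, ← Preadditive.comp_add]
    rfl

/-- Every bounded cochain of `Hom(F, C)` comes from the bottom row. -/
lemma exists_bottomCochain_eq {n : ℤ} {β : Cochain F.cochainComplex C n}
    (hβ : β ∈ boundedCochains F.cochainComplex C n) :
    ∃ w ∈ (resolvedHom F I C).cochains bottom n, bottomCochain F I C n w = β := by
  obtain ⟨b, hb⟩ := hβ
  -- The column `x = i + 1` holds `F_i`, since index `0` is taken by the resolved module.
  let w : (resolvedHom F I C).Fam := fun
    | 0, _, _ => 0
    | _ + 1, _ + 1, _ => 0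
    | i + 1, 0, q => if h : -(i : ℤ) + n = q then
        ((TensorProduct.lid R (C.X q)).symm.toLinearMap ∘ₗ
          ((F.cochainComplexXIso (-i) i).inv ≫ β.v (-i) q h).hom :
            F.complex.X i →ₗ[R] R ⊗[R] C.X q) else 0
  refine ⟨w, ⟨⟨b + n, fun x y q h => ?_⟩, fun x y q h => ?_⟩, bottomCochain_ext fun i q hq => ?_⟩
  · rcases x with _ | i <;> rcases y with _ | y
    · rfl
    · rfl
    · by_cases hq : -(i : ℤ) + n = q
      · refine (dif_pos hq).trans ?_
        rw [hb (-i) q hq (by lia), Limits.comp_zero]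
        exact LinearMap.comp_zero _
      · exact dif_neg hq
    · rfl
  · rcases x with _ | i <;> rcases y with _ | y
    · rfl
    · rfl
    · exact dif_neg fun hq => h ⟨by push_cast; lia, Nat.succ_pos _, rfl⟩
    · rfl
  · rw [bottomCochain_v n w i (-i) q hq rfl]
    have : bottomHom w i q = ((F.cochainComplexXIso (-i) i).inv ≫ β.v (-i) q hq).hom := by
      have e : w (i + 1) 0 q = _ := dif_pos hq
      rw [bottomHom, bottomTerm, e]
      refine LinearMap.ext fun t => ?_
      exact (TensorProduct.lid R (C.X q)).apply_symm_apply _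
    rw [this]
    exact Iso.hom_inv_id_assoc _ _

lemma bottomCochain_famAct {n a m : ℤ} (h : n + a = m) (α : Cochain C C a)
    (w : (resolvedHom F I C).Fam) :
    bottomCochain F I C m (famAct _ _ α w) = (bottomCochain F I C n w).comp α h := by
  refine bottomCochain_ext fun i q hq => ?_
  rw [bottomCochain_v m _ i (-i) q _ rfl, Cochain.comp_v _ α h (-i) (q - a) q (by lia) (by lia),
    bottomCochain_v n w i (-i) (q - a) (by lia) rfl, Category.assoc]
  congr 1
  ext t
  have e : bottomTerm (famAct _ _ α w) i q =
      (α.v (q - a) q (by lia)).hom.lTensor R ∘ₗ bottomTerm w i (q - a) := by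
    refine LinearMap.ext fun t => ?_
    change ((a * ((0 : ℕ) : ℤ)).negOnePow : ℤ) •
      (α.v (q - a) q _).hom.lTensor R (bottomTerm w i (q - a) t) = _
    rw [Nat.cast_zero, mul_zero, Int.negOnePow_zero, Units.val_one, one_smul]
    rfl
  change TensorProduct.lid R (C.X q) (bottomTerm (famAct _ _ α w) i q t) =
    (α.v (q - a) q _).hom (TensorProduct.lid R (C.X (q - a)) (bottomTerm w i (q - a) t))
  rw [← lid_lTensor, e]
  rfl

end Resolutions

end BoundedCohomology

/-! ## Homotopy retracts onto cohomology over a field -/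

section Field

variable {K : Type u} [Field K]

/-- A section of `d` onto its range, extended to all of `W`, is a generalized inverse. -/
lemma LinearMap.exists_comp_comp_eq {V W : Type*} [AddCommGroup V] [Module K V] [AddCommGroup W]
    [Module K W] (d : V →ₗ[K] W) : ∃ g : W →ₗ[K] V, ∀ v, d (g (d v)) = d v := by
  obtain ⟨r, hr⟩ := d.rangeRestrict.exists_rightInverse_of_surjective d.range_rangeRestrict
  obtain ⟨g, hg⟩ := LinearMap.exists_extend r
  refine ⟨g, fun v => ?_⟩
  have h1 : g (d v) = r (d.rangeRestrict v) := LinearMap.congr_fun hg (d.rangeRestrict v)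
  rw [h1]
  exact congrArg Subtype.val (LinearMap.congr_fun hr (d.rangeRestrict v))

/-- A cochain complex over a field retracts onto its cohomology `E`, up to homotopy. -/
lemma exists_homotopyRetract {V E : ℕ → Type u} [∀ i, AddCommGroup (V i)] [∀ i, Module K (V i)]
    [∀ i, AddCommGroup (E i)] [∀ i, Module K (E i)] (d : ∀ i, V i →ₗ[K] V (i + 1))
    (hd : ∀ i v, d (i + 1) (d i v) = 0) (κ : ∀ i, LinearMap.ker (d i) →ₗ[K] E i)
    (hκ : ∀ i, Function.Surjective (κ i)) (hκ0 : Function.Injective (κ 0))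
    (hκd : ∀ i z, κ (i + 1) z = 0 ↔ ∃ v, d i v = z.1) :
    ∃ (π : ∀ i, V i →ₗ[K] E i) (σ : ∀ i, E i →ₗ[K] V i) (s : ∀ i, V (i + 1) →ₗ[K] V i),
      (∀ i v, π (i + 1) (d i v) = 0) ∧ (∀ i x, d i (σ i x) = 0) ∧ (∀ i x, π i (σ i x) = x) ∧
      (∀ v, v = σ 0 (π 0 v) + s 0 (d 0 v)) ∧
      ∀ i v, v = σ (i + 1) (π (i + 1) v) + d i (s i v) + s (i + 1) (d (i + 1) v) := by
  choose g hg using fun i => (d i).exists_comp_comp_eq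
  choose τ hτ using fun i => (κ i).exists_rightInverse_of_surjective
    (LinearMap.range_eq_top.2 (hκ i))
  have hτ' (i x) : κ i (τ i x) = x := LinearMap.congr_fun (hτ i) x
  -- Since `d g d = d`, the map `1 - g d` is a projection onto the cocycles.
  let p (i) : V i →ₗ[K] LinearMap.ker (d i) :=
    (LinearMap.id - g i ∘ₗ d i).codRestrict _ fun v => by simp [hg]
  have hp (i v) : (p i v).1 = v - g i (d i v) := rfl
  have hpz (i) (z : V i) (hz : d i z = 0) : p i z = ⟨z, hz⟩ := Subtype.ext (by simp [hp, hz])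
  let π (i) : V i →ₗ[K] E i := κ i ∘ₗ p i
  let σ (i) : E i →ₗ[K] V i := (LinearMap.ker (d i)).subtype ∘ₗ τ i
  have hσ (i x) : d i (σ i x) = 0 := (τ i x).2
  have hπd (i v) : π (i + 1) (d i v) = 0 := by
    change κ (i + 1) (p (i + 1) (d i v)) = 0
    rw [hpz _ _ (hd i v)]
    exact (hκd i _).2 ⟨v, rfl⟩
  have hdiff (i v) : κ i (p i v - τ i (π i v)) = 0 := by
    rw [map_sub, hτ', sub_eq_zero]
    rfl
  -- The bracket has the boundaries as its values, and `g` lifts them through `d`. On boundaries the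
  -- last two terms of the bracket vanish, so `s d = g d`.
  refine ⟨π, σ, fun i => g i ∘ₗ (LinearMap.id - g (i + 1) ∘ₗ d (i + 1) - σ (i + 1) ∘ₗ π (i + 1)),
    hπd, hσ, fun i x => ?_, fun v => ?_, fun i v => ?_⟩
  · exact (congrArg (κ i) (hpz i _ (hσ i x))).trans (hτ' i x)
  · have h0 : v - g 0 (d 0 v) = σ 0 (π 0 v) := by
      have := hκ0 ((hdiff 0 v).trans (map_zero _).symm)
      exact congrArg Subtype.val (sub_eq_zero.1 this)
    simp only [LinearMap.comp_apply, LinearMap.sub_apply, LinearMap.id_apply, hd, hπd, map_zero,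
      sub_zero, ← h0]
    abel
  · obtain ⟨y, hy⟩ := (hκd i _).1 (hdiff (i + 1) v)
    have hy' : d i y = v - g (i + 1) (d (i + 1) v) - σ (i + 1) (π (i + 1) v) := hy
    simp only [LinearMap.comp_apply, LinearMap.sub_apply, LinearMap.id_apply, hd, hπd, map_zero,
      sub_zero, ← hy', hg]
    rw [hy']
    abel

end Field

/-! ## Homomorphisms into tensor products with projective modules -/

section HomTensor

variable {R : Type u} [CommRing R]

lemma TensorProduct.finsuppScalarRight_rTensorHom {M J : Type u} [AddCommGroup M] [Module R M]
    [AddCommGroup J] [Module R J] (ι : Type u) [DecidableEq ι]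
    (y : (M →ₗ[R] J) ⊗[R] (ι →₀ R)) (m : M) (i : ι) :
    TensorProduct.finsuppScalarRight R R J ι
        (TensorProduct.rTensorHomToHomRTensor (.id R) M J (ι →₀ R) y m) i =
      TensorProduct.finsuppScalarRight R R (M →ₗ[R] J) ι y i m := by
  induction y with
  | zero => simp
  | add s t hs ht => simp only [map_add, LinearMap.add_apply, Finsupp.add_apply, hs, ht]
  | tmul f p => simp [TensorProduct.finsuppScalarRight_apply_tmul_apply]

/-- For `M` finite and `P` projective, `Hom(M, J) ⊗ P` is `Hom(M, J ⊗ P)`. -/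
lemma TensorProduct.rTensorHomToHomRTensor_bijective (M J P : Type u) [AddCommGroup M] [Module R M]
    [Module.Finite R M] [AddCommGroup J] [Module R J] [AddCommGroup P] [Module R P]
    [Module.Projective R P] :
    Function.Bijective (TensorProduct.rTensorHomToHomRTensor (.id R) M J P) := by
  classical
  obtain ⟨s, hs⟩ := Module.projective_def'.1 (inferInstance : Module.Projective R P)
  -- Injectivity is checked after embedding `P` as a direct summand of a free module, where it can
  -- be read off coordinatewise.
  have hs' : Function.Injective (s.lTensor (M →ₗ[R] J)) := by
    refine Function.LeftInverse.injective
      (g := (Finsupp.linearCombination R id).lTensor (M →ₗ[R] J)) fun x => ?_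
    rw [← LinearMap.lTensor_comp_apply, hs, LinearMap.lTensor_id, LinearMap.id_apply]
  constructor
  · refine (injective_iff_map_eq_zero _).2 fun t ht => ?_
    refine hs' (((TensorProduct.finsuppScalarRight R R (M →ₗ[R] J) P).map_eq_zero_iff.1 ?_).trans
      (map_zero _).symm)
    ext i m
    rw [← TensorProduct.finsuppScalarRight_rTensorHom]
    have e : TensorProduct.rTensorHomToHomRTensor (.id R) M J (P →₀ R) (s.lTensor _ t) m =
        s.lTensor J (TensorProduct.rTensorHomToHomRTensor (.id R) M J P t m) := by
      clear ht
      induction t with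
      | zero => simp
      | add s t hs ht => simp only [map_add, LinearMap.add_apply, hs, ht]
      | tmul f p => simp
    rw [e, ht]
    simp
  · intro f
    let e := TensorProduct.finsuppScalarRight R R J P
    let g : M →ₗ[R] P →₀ J := e.toLinearMap ∘ₗ s.lTensor J ∘ₗ f
    obtain ⟨T, hT⟩ := g.exists_finset_support
    -- The coordinate of `g` at the basis vector of `p` is tensored with `p`, the image of that
    -- vector in `P`. Finiteness of `M` makes the sum finite.
    refine ⟨∑ p ∈ T, (Finsupp.lapply p ∘ₗ g) ⊗ₜ p, LinearMap.ext fun m => ?_⟩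
    have h1 : f m = (Finsupp.linearCombination R id).lTensor J (e.symm (g m)) := by
      change f m = (Finsupp.linearCombination R id).lTensor J (e.symm (e (s.lTensor J (f m))))
      rw [LinearEquiv.symm_apply_apply, ← LinearMap.lTensor_comp_apply, hs, LinearMap.lTensor_id,
        LinearMap.id_apply]
    have h2 : g m = ∑ p ∈ T, Finsupp.single p (g m p) := by
      ext p
      simp only [Finsupp.finsetSum_apply, Finsupp.single_apply, Finset.sum_ite_eq']
      split_ifs with h
      · rfl
      · exact hT p h m
    rw [h1, h2, map_sum, map_sum, map_sum, LinearMap.sum_apply]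
    refine Finset.sum_congr rfl fun p hp => ?_
    simp [e, TensorProduct.finsuppScalarRight_symm_apply_single]

end HomTensor

/-! ## `Ext` of the residue field -/

namespace BoundedCohomology

section ExtMk

variable {R : Type u} [CommRing R] {X Y : ModuleCat.{u} R} (I : InjectiveResolution Y)

/-- Scalar multiplication on `Ext` is precomposition with `r • 𝟙 X`, which acts directly on
representing cocycles. -/
lemma smul_extMk {n : ℕ} (r : R) (f : X ⟶ I.cocomplex.X n) (m : ℕ) (hm : n + 1 = m)
    (hf : f ≫ I.cocomplex.d n m = 0) :
    r • I.extMk f m hm hf = I.extMk (r • f) m hm (by rw [Linear.smul_comp, hf, smul_zero]) := by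
  have e : (Abelian.Ext.mk₀ (r • 𝟙 X)).comp (I.extMk f m hm hf) (zero_add _) =
      r • I.extMk f m hm hf := by
    rw [Abelian.Ext.mk₀_smul, Abelian.Ext.smul_comp, Abelian.Ext.mk₀_id_comp]
  rw [← e, I.mk₀_comp_extMk]
  congr 1
  rw [Linear.smul_comp, Category.id_comp]

/-- The injective resolution is zero in degree `-1`, so the only coboundary in degree `0` is zero.
-/
lemma extMk_zero_eq_zero (f : X ⟶ I.cocomplex.X 0) (m : ℕ) (hm : 0 + 1 = m)
    (hf : f ≫ I.cocomplex.d 0 m = 0) (h : I.extMk f m hm hf = 0) : f = 0 := by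
  rw [← I.extEquivCohomologyClass.apply_eq_iff_eq, I.extEquivCohomologyClass_extMk,
    I.extEquivCohomologyClass_zero, CohomologyClass.mk_eq_zero_iff,
    Cocycle.fromSingleMk_mem_coboundaries_iff _ _ _ _ _ (-1) (by lia)] at h
  obtain ⟨g, hg⟩ := h
  rw [(CochainComplex.isZero_of_isStrictlyGE I.cochainComplex 0 (-1) (by lia)).eq_of_tgt g 0,
    Limits.zero_comp] at hg
  rw [← cancel_mono (I.cochainComplexXIso _ 0 rfl).inv, ← hg, Limits.zero_comp]

end ExtMk

variable {R : Type u} [CommRing R] [IsLocalRing R]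

local notation "k" => IsLocalRing.ResidueField R

variable (I : InjectiveResolution (ModuleCat.of R R))

/-- The differential of the complex `Hom(k, I)`. -/
noncomputable def socleD (i : ℕ) : (k →ₗ[R] I.cocomplex.X i) →ₗ[R] (k →ₗ[R] I.cocomplex.X (i + 1)) :=
  LinearMap.compRight R (I.cocomplex.d i (i + 1)).hom

lemma socleD_socleD (i : ℕ) (f : k →ₗ[R] I.cocomplex.X i) : socleD I (i + 1) (socleD I i f) = 0 :=
  LinearMap.ext fun x => hom_d_d I.cocomplex i (i + 1) (i + 1 + 1) (f x)

lemma comp_d_eq_zero {i : ℕ} {f : k →ₗ[R] I.cocomplex.X i} (hf : socleD I i f = 0) :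
    ModuleCat.ofHom f ≫ I.cocomplex.d i (i + 1) = 0 :=
  ModuleCat.hom_ext hf

/-- The map sending a cocycle of `Hom(k, I)` to its class. -/
noncomputable def extClass (i : ℕ) : LinearMap.ker (socleD I i) →ₗ[R] ExtResidue R i where
  toFun f := I.extMk (ModuleCat.ofHom f.1) (i + 1) rfl (comp_d_eq_zero I f.2)
  map_add' f g := by
    have h := I.add_extMk (ModuleCat.ofHom f.1) (ModuleCat.ofHom g.1) (i + 1) rfl
      (comp_d_eq_zero I f.2) (comp_d_eq_zero I g.2)
    rw [h]
    rfl
  map_smul' r f := by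
    have h := smul_extMk I r (ModuleCat.ofHom f.1) (i + 1) rfl (comp_d_eq_zero I f.2)
    rw [RingHom.id_apply, h]
    rfl

lemma extClass_surjective (i : ℕ) : Function.Surjective (extClass I i) := by
  intro x
  obtain ⟨f, hf, rfl⟩ := I.extMk_surjective x (i + 1) rfl
  exact ⟨⟨f.hom, congrArg ModuleCat.Hom.hom hf⟩, rfl⟩

lemma extClass_eq_zero_iff (i : ℕ) (f : LinearMap.ker (socleD I (i + 1))) :
    extClass I (i + 1) f = 0 ↔ ∃ g, socleD I i g = f.1 := by
  refine (I.extMk_eq_zero_iff (ModuleCat.ofHom f.1) (i + 1 + 1) rfl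
    (comp_d_eq_zero I f.2) i rfl).trans ⟨fun ⟨g, hg⟩ => ⟨g.hom, ?_⟩,
    fun ⟨g, hg⟩ => ⟨ModuleCat.ofHom g, ?_⟩⟩
  · exact congrArg ModuleCat.Hom.hom hg
  · exact ModuleCat.hom_ext hg

lemma extClass_zero_injective : Function.Injective (extClass I 0) := by
  refine (injective_iff_map_eq_zero _).2 fun f hf => Subtype.ext ?_
  exact congrArg ModuleCat.Hom.hom 
    (extMk_zero_eq_zero I (ModuleCat.ofHom f.1) (0 + 1) rfl (comp_d_eq_zero I f.2) hf)

instance isScalarTower_extResidue (i : ℕ) : IsScalarTower R k (ExtResidue R i) :=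
  Module.IsTorsionBySet.isScalarTower _

/-- A retraction of the complex `Hom(k, I)` onto `Ext(k, R)`, up to homotopy. -/
structure SocleRetract where
  π (i : ℕ) : (k →ₗ[R] I.cocomplex.X i) →ₗ[R] ExtResidue R i
  σ (i : ℕ) : ExtResidue R i →ₗ[R] (k →ₗ[R] I.cocomplex.X i)
  s (i : ℕ) : (k →ₗ[R] I.cocomplex.X (i + 1)) →ₗ[R] (k →ₗ[R] I.cocomplex.X i)
  π_d (i : ℕ) : π (i + 1) ∘ₗ socleD I i = 0
  d_σ (i : ℕ) : socleD I i ∘ₗ σ i = 0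
  π_σ (i : ℕ) : π i ∘ₗ σ i = LinearMap.id
  homotopy_zero : LinearMap.id = σ 0 ∘ₗ π 0 + s 0 ∘ₗ socleD I 0
  homotopy_succ (i : ℕ) : LinearMap.id = σ (i + 1) ∘ₗ π (i + 1) + socleD I i ∘ₗ s i +
    s (i + 1) ∘ₗ socleD I (i + 1)

/-- The maximal ideal kills `Hom(k, I)`, so this is a complex over the field `k` and splits. The
splitting is kept as `R`-linear maps because it is later tensored over `R` with `G`. -/
lemma nonempty_socleRetract : Nonempty (SocleRetract I) := by
  have htor (i : ℕ) : Module.IsTorsionBySet R (k →ₗ[R] I.cocomplex.X i)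
      (IsLocalRing.maximalIdeal R) := fun f r => LinearMap.ext fun x => by
    rw [LinearMap.smul_apply, ← map_smul, smul_residueField_eq_zero r.1 r.2, map_zero,
      LinearMap.zero_apply]
  let (i : ℕ) : Module k (k →ₗ[R] I.cocomplex.X i) := (htor i).module
  have (i : ℕ) : IsScalarTower R k (k →ₗ[R] I.cocomplex.X i) := (htor i).isScalarTower
  have hk : Function.Surjective (algebraMap R k) := IsLocalRing.residue_surjective
  let d (i : ℕ) := LinearMap.extendScalarsOfSurjective hk (socleD I i)
  let κ (i : ℕ) : LinearMap.ker (d i) →ₗ[k] ExtResidue R i :=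
    LinearMap.extendScalarsOfSurjective hk
      { toFun := fun f => extClass I i ⟨f.1, f.2⟩
        map_add' := fun f g => (extClass I i).map_add ⟨f.1, f.2⟩ ⟨g.1, g.2⟩
        map_smul' := fun r f => (extClass I i).map_smul r ⟨f.1, f.2⟩ }
  obtain ⟨π, σ, s, h1, h2, h3, h4, h5⟩ := exists_homotopyRetract d (fun i v => socleD_socleD I i v)
    κ (fun i x => by
      obtain ⟨f, hf⟩ := extClass_surjective I i x
      exact ⟨⟨f.1, f.2⟩, hf⟩)
    (fun f g h => Subtype.ext (congrArg Subtype.val (extClass_zero_injective I h) :))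
    (fun i z => extClass_eq_zero_iff I i ⟨z.1, z.2⟩)
  exact ⟨⟨fun i => (π i).restrictScalars R, fun i => (σ i).restrictScalars R,
    fun i => (s i).restrictScalars R, fun i => LinearMap.ext (h1 i), fun i => LinearMap.ext (h2 i),
    fun i => LinearMap.ext (h3 i), LinearMap.ext h4, fun i => LinearMap.ext (h5 i)⟩⟩

end BoundedCohomology

namespace BoundedCohomology

/-! ### Homology of a complex of vector spaces tensored with a vector space -/

section FieldHomology

variable {K : Type u} [Field K] (Y : CochainComplex (ModuleCat.{u} K) ℤ)

/-- Extending the class map beyond the cycles gives a linear map on all chains, so `colClass` can be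
defined on arbitrary families. -/
lemma exists_homologyExtension (j : ℤ) :
    ∃ r : Y.X (-j) →ₗ[K] HomologyModule Y j,
      r ∘ₗ (cycles Y j).subtype = ((boundaries Y j).submoduleOf (cycles Y j)).mkQ :=
  LinearMap.exists_extend _

/-- A linear extension to all of `Y_j` of the map sending a cycle to its class. -/
noncomputable def homologyExtension (j : ℤ) : Y.X (-j) →ₗ[K] HomologyModule Y j :=
  (exists_homologyExtension Y j).choose

lemma homologyExtension_comp (j : ℤ) : homologyExtension Y j ∘ₗ (cycles Y j).subtype =
    ((boundaries Y j).submoduleOf (cycles Y j)).mkQ :=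
  (exists_homologyExtension Y j).choose_spec

/-- The differential with values in the cycles. -/
noncomputable def toCycles (j : ℤ) : Y.X (-j - 1) →ₗ[K] cycles Y j :=
  (Y.d (-j - 1) (-j)).hom.codRestrict _ fun y => hom_d_d Y _ _ _ y

lemma toCycles_exact (j : ℤ) : Function.Exact (toCycles Y j)
    ((boundaries Y j).submoduleOf (cycles Y j)).mkQ := by
  intro z
  rw [Submodule.mkQ_apply, Submodule.Quotient.mk_eq_zero]
  exact ⟨fun ⟨y, hy⟩ => ⟨y, Subtype.ext hy⟩, fun ⟨y, hy⟩ => ⟨y, congrArg Subtype.val hy⟩⟩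

lemma cycles_exact (j : ℤ) :
    Function.Exact (cycles Y j).subtype (Y.d (-j) (-j + 1)).hom := fun y =>
  ⟨fun hy => ⟨⟨y, hy⟩, rfl⟩, fun ⟨z, hz⟩ => hz ▸ z.2⟩

variable (E : Type u) [AddCommGroup E] [Module K E]

variable {Y E}

lemma homologyExtension_lTensor_subtype {j : ℤ} (z : E ⊗[K] cycles Y j) :
    (homologyExtension Y j).lTensor E ((cycles Y j).subtype.lTensor E z) =
      ((boundaries Y j).submoduleOf (cycles Y j)).mkQ.lTensor E z := by
  rw [← LinearMap.lTensor_comp_apply, homologyExtension_comp]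

/-- Tensoring with `E` preserves the exact sequences that define cycles and homology, so a cycle
with trivial class is still a boundary. -/
lemma exists_lTensor_d_eq {j : ℤ} {x : E ⊗[K] Y.X (-j)}
    (hx : (Y.d (-j) (-j + 1)).hom.lTensor E x = 0)
    (hr : (homologyExtension Y j).lTensor E x = 0) :
    ∃ y, (Y.d (-j - 1) (-j)).hom.lTensor E y = x := by
  obtain ⟨z, rfl⟩ := (Module.Flat.lTensor_exact E (cycles_exact Y j) x).1 hx
  rw [homologyExtension_lTensor_subtype] at hr
  obtain ⟨y, rfl⟩ := (lTensor_exact E (toCycles_exact Y j) (Submodule.mkQ_surjective _) z).1 hr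
  exact ⟨y, by rw [← LinearMap.lTensor_comp_apply]; rfl⟩

lemma exists_lTensor_cycle_eq {j : ℤ} (t : E ⊗[K] HomologyModule Y j) :
    ∃ x, (Y.d (-j) (-j + 1)).hom.lTensor E x = 0 ∧ (homologyExtension Y j).lTensor E x = t := by
  obtain ⟨z, rfl⟩ := LinearMap.lTensor_surjective E (Submodule.mkQ_surjective
    ((boundaries Y j).submoduleOf (cycles Y j))) t
  exact ⟨(cycles Y j).subtype.lTensor E z,
    (Module.Flat.lTensor_exact E (cycles_exact Y j)).apply_apply_eq_zero z,
    homologyExtension_lTensor_subtype z⟩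

lemma homologyExtension_lTensor_d {j : ℤ} (y : E ⊗[K] Y.X (-j - 1)) :
    (homologyExtension Y j).lTensor E ((Y.d (-j - 1) (-j)).hom.lTensor E y) = 0 := by
  have e : (Y.d (-j - 1) (-j)).hom = (cycles Y j).subtype ∘ₗ toCycles Y j := rfl
  rw [e, LinearMap.lTensor_comp_apply, homologyExtension_lTensor_subtype]
  exact (lTensor_exact E (toCycles_exact Y j)
    (Submodule.mkQ_surjective _)).apply_apply_eq_zero y

lemma homologyExtension_lTensor_cocycle {a j l : ℤ} (h : l + a = j) (α : Cocycle Y Y a)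
    {x : E ⊗[K] Y.X (-j)} (hx : (Y.d (-j) (-j + 1)).hom.lTensor E x = 0) :
    (homologyExtension Y l).lTensor E ((α.1.v (-j) (-l) (by lia)).hom.lTensor E x) =
      (homologyAct h (CohomologyClass.mk α)).lTensor E ((homologyExtension Y j).lTensor E x) := by
  obtain ⟨z, rfl⟩ := (Module.Flat.lTensor_exact E (cycles_exact Y j) x).1 hx
  have e : (α.1.v (-j) (-l) (by lia)).hom.lTensor E ((cycles Y j).subtype.lTensor E z) =
      (cycles Y l).subtype.lTensor E ((cyclesMap h α).lTensor E z) := by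
    rw [← LinearMap.lTensor_comp_apply, ← LinearMap.lTensor_comp_apply]
    rfl
  rw [homologyExtension_lTensor_subtype, e, homologyExtension_lTensor_subtype,
    ← LinearMap.lTensor_comp_apply, ← LinearMap.lTensor_comp_apply]
  rfl

end FieldHomology

/-! ### Reduction to the residue field -/

section Residue

variable {R : Type u} [CommRing R] [IsLocalRing R]

local notation "k" => IsLocalRing.ResidueField R

variable {C : CochainComplex (ModuleCat.{u} R) ℤ} {E : Type u} [AddCommGroup E] [Module R E]
  [Module (IsLocalRing.ResidueField R) E] [IsScalarTower R (IsLocalRing.ResidueField R) E]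

variable (C E) in
/-- The isomorphism `E ⊗_R C_q ≃ E ⊗_k (k ⊗_R C_q)` for a vector space `E`. -/
noncomputable def residueTensorEquiv (q : ℤ) : E ⊗[R] C.X q ≃ₗ[k] E ⊗[k] (residueTensor C).X q :=
  (TensorProduct.AlgebraTensorModule.cancelBaseChange R k k E (C.X q)).symm

lemma residueTensorEquiv_lTensor {p q : ℤ} (f : C.X p ⟶ C.X q)
    (g : (residueTensor C).X p ⟶ (residueTensor C).X q)
    (hg : g = (ModuleCat.extendScalars.{u, u, u} (algebraMap R k)).map f) (x : E ⊗[R] C.X p) :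
    residueTensorEquiv C E q (f.hom.lTensor E x) =
      g.hom.lTensor E (residueTensorEquiv C E p x) := by
  subst hg
  induction x with
  | zero => rw [map_zero, map_zero, map_zero, map_zero]
  | add s t hs ht => rw [map_add, map_add, map_add, map_add, hs, ht]
  | tmul x m => rfl

variable (C E) in
/-- A linear map `E ⊗_R C_j → E ⊗_k H_j(k ⊗_R C)` sending cycles to their classes. -/
noncomputable def tensorClass (j : ℤ) :
    E ⊗[R] C.X (-j) →ₗ[k] E ⊗[k] HomologyModule (residueTensor C) j :=
  (homologyExtension (residueTensor C) j).lTensor E ∘ₗ (residueTensorEquiv C E (-j)).toLinearMap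

lemma exists_lTensor_d_eq_of_tensorClass_eq_zero {j : ℤ} {x : E ⊗[R] C.X (-j)}
    (hx : (C.d (-j) (-j + 1)).hom.lTensor E x = 0) (hr : tensorClass C E j x = 0) :
    ∃ y, (C.d (-j - 1) (-j)).hom.lTensor E y = x := by
  have hx' := residueTensorEquiv_lTensor (C.d (-j) (-j + 1))
    ((residueTensor C).d (-j) (-j + 1)) rfl x
  rw [hx, map_zero] at hx'
  obtain ⟨y, hy⟩ := exists_lTensor_d_eq (Y := residueTensor C) hx'.symm hr
  refine ⟨(residueTensorEquiv C E _).symm y, (residueTensorEquiv C E _).injective ?_⟩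
  rw [residueTensorEquiv_lTensor _ ((residueTensor C).d (-j - 1) (-j)) rfl,
    LinearEquiv.apply_symm_apply]
  exact hy

lemma exists_tensorClass_eq {j : ℤ} (t : E ⊗[k] HomologyModule (residueTensor C) j) :
    ∃ x, (C.d (-j) (-j + 1)).hom.lTensor E x = 0 ∧ tensorClass C E j x = t := by
  obtain ⟨y, hy, rfl⟩ := exists_lTensor_cycle_eq t
  refine ⟨(residueTensorEquiv C E _).symm y, (residueTensorEquiv C E _).injective ?_, ?_⟩
  · rw [residueTensorEquiv_lTensor _ ((residueTensor C).d (-j) (-j + 1)) rfl,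
      LinearEquiv.apply_symm_apply, map_zero]
    exact hy
  · change (homologyExtension (residueTensor C) j).lTensor E
      (residueTensorEquiv C E _ ((residueTensorEquiv C E _).symm y)) = _
    rw [LinearEquiv.apply_symm_apply]

lemma tensorClass_lTensor_d {j : ℤ} (y : E ⊗[R] C.X (-j - 1)) :
    tensorClass C E j ((C.d (-j - 1) (-j)).hom.lTensor E y) = 0 := by
  change (homologyExtension (residueTensor C) j).lTensor E (residueTensorEquiv C E _ _) = 0
  rw [residueTensorEquiv_lTensor _ ((residueTensor C).d (-j - 1) (-j)) rfl]
  exact homologyExtension_lTensor_d (Y := residueTensor C) _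

lemma tensorClass_lTensor_cocycle {N : ModuleCat.{u} R} (G : ProjectiveResolution N) {a j l : ℤ}
    (h : l + a = j) (α : Cocycle G.cochainComplex G.cochainComplex a)
    {x : E ⊗[R] G.cochainComplex.X (-j)}
    (hx : (G.cochainComplex.d (-j) (-j + 1)).hom.lTensor E x = 0) :
    tensorClass G.cochainComplex E l ((α.1.v (-j) (-l) (by lia)).hom.lTensor E x) =
      (torAct G h (CohomologyClass.mk α)).lTensor E (tensorClass G.cochainComplex E j x) := by
  have hx' := residueTensorEquiv_lTensor (G.cochainComplex.d (-j) (-j + 1))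
    ((residueTensor G.cochainComplex).d (-j) (-j + 1)) rfl x
  rw [hx, map_zero] at hx'
  refine Eq.trans ?_ (homologyExtension_lTensor_cocycle h
    (residueTensorCocycle G.cochainComplex a α) hx'.symm)
  exact congrArg _ (residueTensorEquiv_lTensor _ _ rfl x)

end Residue

end BoundedCohomology

/-- The linear map to a direct sum with given components, almost all of which vanish at every
element. -/
noncomputable def DirectSum.ofFiniteSupport {R W ι : Type*} [CommRing R] [AddCommGroup W]
    [Module R W] {M : ι → Type*} [∀ p, AddCommGroup (M p)] [∀ p, Module R (M p)]
    (f : ∀ p, W →ₗ[R] M p) (hf : ∀ w, {p | f p w ≠ 0}.Finite) : W →ₗ[R] ⨁ p, M p :=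
  have := Classical.decEq ι
  have key (w : W) (p : ι) : DFinsupp.mk (hf w).toFinset (fun p => f p.1 w) p = f p w := by
    rw [DFinsupp.mk_apply]
    split_ifs with h
    · rfl
    · by_contra hne
      exact h ((hf w).mem_toFinset.2 (Ne.symm hne))
  { toFun w := DFinsupp.mk (hf w).toFinset fun p => f p.1 w
    map_add' v w := DFinsupp.ext fun p => by
      rw [DFinsupp.add_apply, key, key, key, map_add]
    map_smul' r w := DFinsupp.ext fun p => by
      rw [RingHom.id_apply, DFinsupp.smul_apply, key, key, map_smul] }

lemma DirectSum.ofFiniteSupport_apply {R W ι : Type*} [CommRing R] [AddCommGroup W]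
    [Module R W] {M : ι → Type*} [∀ p, AddCommGroup (M p)] [∀ p, Module R (M p)]
    (f : ∀ p, W →ₗ[R] M p) (hf : ∀ w, {p | f p w ≠ 0}.Finite) (w : W) (p : ι) :
    DirectSum.ofFiniteSupport f hf w p = f p w := by
  classical
  refine (DFinsupp.mk_apply (s := (hf w).toFinset) (x := fun p => f p.1 w)).trans ?_
  split_ifs with h
  · rfl
  · by_contra hne
    exact h ((hf w).mem_toFinset.2 (Ne.symm hne))

namespace BoundedCohomology

open TripleComplex

/-- Naturality in the projective factor transports both the differential of `G` and the action of
`Hom(G, G)` to the left column. -/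
lemma rTensorHom_lTensor {R : Type u} [CommRing R] {M J P Q : Type u} [AddCommGroup M] [Module R M] [AddCommGroup J]
    [Module R J] [AddCommGroup P] [Module R P] [AddCommGroup Q] [Module R Q] (f : P →ₗ[R] Q)
    (t : (M →ₗ[R] J) ⊗[R] P) :
    TensorProduct.rTensorHomToHomRTensor (.id R) M J Q (f.lTensor _ t) =
      f.lTensor J ∘ₗ TensorProduct.rTensorHomToHomRTensor (.id R) M J P t := by
  induction t with
  | zero => simp
  | add s t hs ht => simp only [map_add, hs, ht, LinearMap.comp_add]
  | tmul g p =>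
    ext x
    simp

/-! ### The left column as `Hom(k, I) ⊗ G` -/

section LeftColumn

variable {R : Type u} [CommRing R] [IsLocalRing R]

local notation "k" => IsLocalRing.ResidueField R

variable {N : ModuleCat.{u} R} 
  (F : ProjectiveResolution (ModuleCat.of R (IsLocalRing.ResidueField R)))
  {I : InjectiveResolution (ModuleCat.of R R)} (G : ProjectiveResolution N)

/-- The terms of the first column of the triple complex. -/
noncomputable def leftEquiv (i : ℕ) (q : ℤ) :
    (k →ₗ[R] I.cocomplex.X i) ⊗[R] G.cochainComplex.X q ≃ₗ[R]
      (resolvedHom F I G.cochainComplex).X 0 (i + 1) q :=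
  have := projective_cochainComplex G q
  LinearEquiv.ofBijective
    (TensorProduct.rTensorHomToHomRTensor (.id R) k (I.cocomplex.X i) (G.cochainComplex.X q))
    (TensorProduct.rTensorHomToHomRTensor_bijective _ _ _)

lemma dy_leftEquiv (i : ℕ) (q : ℤ)
    (t : (k →ₗ[R] I.cocomplex.X i) ⊗[R] G.cochainComplex.X q) :
    (resolvedHom F I G.cochainComplex).dy 0 (i + 1) q (leftEquiv F G i q t) =
      leftEquiv F G (i + 1) q ((socleD I i).rTensor _ t) := by
  induction t with
  | zero => simp only [map_zero]
  | add s t hs ht => simp only [map_add, hs, ht]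
  | tmul f g => rfl

lemma dz_leftEquiv (i : ℕ) (q : ℤ)
    (t : (k →ₗ[R] I.cocomplex.X i) ⊗[R] G.cochainComplex.X (q - 1)) :
    (resolvedHom F I G.cochainComplex).dz 0 (i + 1) q (leftEquiv F G i (q - 1) t) =
      (((i + 1 : ℕ) : ℤ).negOnePow : ℤ) •
        leftEquiv F G i q ((G.cochainComplex.d (q - 1) q).hom.lTensor _ t) :=
  congrArg ((((i + 1 : ℕ) : ℤ).negOnePow : ℤ) • ·) (rTensorHom_lTensor _ t).symm

lemma termAct_leftEquiv {a : ℤ} (α : Cochain G.cochainComplex G.cochainComplex a) (i : ℕ)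
    (r q : ℤ) (h : r + a = q) (t : (k →ₗ[R] I.cocomplex.X i) ⊗[R] G.cochainComplex.X r) :
    termAct (augmentedProj F) (augmentedInj I) α 0 (i + 1) r q h (leftEquiv F G i r t) =
      ((a * (i + 1 : ℕ)).negOnePow : ℤ) • leftEquiv F G i q ((α.v r q h).hom.lTensor _ t) :=
  congrArg (((a * (i + 1 : ℕ)).negOnePow : ℤ) • ·) (rTensorHom_lTensor _ t).symm

variable {F G} (S : SocleRetract I)

/-- The component in `Hom(k, I^i) ⊗ G_q` of a family. -/
noncomputable def leftComp (w : (resolvedHom F I G.cochainComplex).Fam) (i : ℕ) (q : ℤ) :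
    (k →ₗ[R] I.cocomplex.X i) ⊗[R] G.cochainComplex.X q :=
  (leftEquiv F G i q).symm (w 0 (i + 1) q)

lemma leftEquiv_leftComp (w : (resolvedHom F I G.cochainComplex).Fam) (i : ℕ) (q : ℤ) :
    leftEquiv F G i q (leftComp w i q) = w 0 (i + 1) q :=
  LinearEquiv.apply_symm_apply _ _

/-- The component in `Ext^i(k, R) ⊗ G_q` of a family. -/
noncomputable def extComp (w : (resolvedHom F I G.cochainComplex).Fam) (i : ℕ) (q : ℤ) :
    ExtResidue R i ⊗[R] G.cochainComplex.X q :=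
  (S.π i).rTensor _ (leftComp w i q)

variable {S} {n : ℤ} {w : (resolvedHom F I G.cochainComplex).Fam}

lemma lTensor_d_leftComp_zero (hw : w ∈ (resolvedHom F I G.cochainComplex).cochains offCorner n)
    (hdw : ∀ y q, (resolvedHom F I G.cochainComplex).d w 0 y q = 0) (q : ℤ) :
    (G.cochainComplex.d (q - 1) q).hom.lTensor _ (leftComp w 0 (q - 1)) = 0 := by
  have h0 : w 0 0 q = 0 := hw.2 0 0 q fun h => by simp [offCorner] at h
  have e := hdw 1 q
  rw [d_apply] at e
  simp only [dX, dY, dZ, h0, map_zero, zero_add] at e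
  have e' : (resolvedHom F I G.cochainComplex).dz 0 (0 + 1) q
    (leftEquiv F G 0 (q - 1) (leftComp w 0 (q - 1))) = 0 := by
    rw [leftEquiv_leftComp]
    exact e
  rw [dz_leftEquiv, ← Units.smul_def] at e'
  exact (LinearEquiv.map_eq_zero_iff _).1 ((smul_eq_zero_iff_eq _).1 e')

/-- This is the cocycle condition at height `i + 2`: two adjacent components of the left column
cancel there. -/
lemma socleD_leftComp (hdw : ∀ y q, (resolvedHom F I G.cochainComplex).d w 0 y q = 0)
    (i : ℕ) (q : ℤ) : (socleD I i).rTensor _ (leftComp w i q) =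
      (((i + 1 : ℕ) : ℤ).negOnePow : ℤ) •
        (G.cochainComplex.d (q - 1) q).hom.lTensor _ (leftComp w (i + 1) (q - 1)) := by
  have e := hdw (i + 1 + 1) q
  rw [d_apply] at e
  simp only [dX, dY, dZ, zero_add] at e
  rw [← leftEquiv_leftComp w i q, ← leftEquiv_leftComp w (i + 1) (q - 1), dy_leftEquiv,
    dz_leftEquiv, ← map_zsmul, ← map_add, LinearEquiv.map_eq_zero_iff] at e
  rw [eq_neg_of_add_eq_zero_left e, Nat.cast_succ (i + 1), Int.negOnePow_succ, Units.val_neg,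
    neg_smul, neg_neg]

/-- The differential of `leftComp` comes from the socle differential, which `π` kills; in index `0`
it is already zero because the corner is. -/
lemma lTensor_d_extComp (hw : w ∈ (resolvedHom F I G.cochainComplex).cochains offCorner n)
    (hdw : ∀ y q, (resolvedHom F I G.cochainComplex).d w 0 y q = 0) (i : ℕ) (p q : ℤ)
    (h : p + 1 = q) : (G.cochainComplex.d p q).hom.lTensor _ (extComp S w i p) = 0 := by
  obtain rfl : p = q - 1 := by lia
  rw [extComp, ← rTensor_lTensor_comm]
  rcases i with _ | i
  · rw [lTensor_d_leftComp_zero hw hdw, map_zero]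
  · have e := congrArg ((S.π (i + 1)).rTensor _) (socleD_leftComp hdw i q)
    rw [← LinearMap.rTensor_comp_apply, S.π_d, LinearMap.rTensor_zero, LinearMap.zero_apply,
      map_zsmul, eq_comm, ← Units.smul_def] at e
    exact (smul_eq_zero_iff_eq _).1 e

end LeftColumn

/-! ### Classes in `Ext ⊗ Tor` of families in the left column -/

section ColumnClass

variable {R : Type u} [CommRing R] [IsLocalRing R]

local notation "k" => IsLocalRing.ResidueField R

variable {N : ModuleCat.{u} R}
  {F : ProjectiveResolution (ModuleCat.of R (IsLocalRing.ResidueField R))}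
  {I : InjectiveResolution (ModuleCat.of R R)} {G : ProjectiveResolution N}

lemma leftComp_eq_zero {w : (resolvedHom F I G.cochainComplex).Fam} {i : ℕ} {q : ℤ}
    (h : w 0 (i + 1) q = 0) : leftComp w i q = 0 := by
  rw [leftComp, h, map_zero]

lemma leftComp_d_zero {z : (resolvedHom F I G.cochainComplex).Fam} {q : ℤ} (h0 : z 0 0 q = 0) :
    leftComp ((resolvedHom F I G.cochainComplex).d z) 0 q =
      (((0 + 1 : ℕ) : ℤ).negOnePow : ℤ) •
        (G.cochainComplex.d (q - 1) q).hom.lTensor _ (leftComp z 0 (q - 1)) := by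
  rw [leftComp, LinearEquiv.symm_apply_eq, map_zsmul, ← dz_leftEquiv, leftEquiv_leftComp, d_apply]
  simp only [dX, dY, dZ, h0, map_zero, zero_add]

lemma leftComp_d_succ (z : (resolvedHom F I G.cochainComplex).Fam) (i : ℕ) (q : ℤ) :
    leftComp ((resolvedHom F I G.cochainComplex).d z) (i + 1) q =
      (socleD I i).rTensor _ (leftComp z i q) + (((i + 1 + 1 : ℕ) : ℤ).negOnePow : ℤ) •
        (G.cochainComplex.d (q - 1) q).hom.lTensor _ (leftComp z (i + 1) (q - 1)) := by
  rw [leftComp, LinearEquiv.symm_apply_eq, map_add, map_zsmul, ← dz_leftEquiv, ← dy_leftEquiv,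
    leftEquiv_leftComp, leftEquiv_leftComp, d_apply]
  simp only [dX, dY, dZ, zero_add]

variable (S : SocleRetract I)

/-- The component in `Ext^i(k, R) ⊗ Tor_j(k, N)` of a family. -/
noncomputable def colClass (i : ℕ) (j : ℤ) : (resolvedHom F I G.cochainComplex).Fam →ₗ[R]
    ExtResidue R i ⊗[k] TorResidue G j where
  toFun w := tensorClass G.cochainComplex (ExtResidue R i) j (extComp S w i (-j))
  map_add' v w := by
    rw [← map_add]
    exact congrArg _ ((congrArg _ (map_add (leftEquiv F G i (-j)).symm _ _)).trans
      (map_add ((S.π i).rTensor _) _ _))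
  map_smul' r w := by
    rw [RingHom.id_apply, ← LinearMap.map_smul_of_tower]
    exact congrArg _ ((congrArg _ (map_smul (leftEquiv F G i (-j)).symm r _)).trans
      (map_smul ((S.π i).rTensor _) r _))

lemma colClass_apply (i : ℕ) (j : ℤ) (w : (resolvedHom F I G.cochainComplex).Fam) :
    colClass S i j w =
      tensorClass G.cochainComplex (ExtResidue R i) j (extComp S w i (-j)) := rfl

lemma extComp_eq_zero {w : (resolvedHom F I G.cochainComplex).Fam} {i : ℕ} {q : ℤ}
    (h : w 0 (i + 1) q = 0) : extComp S w i q = 0 := by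
  rw [extComp, leftComp_eq_zero h, map_zero]

lemma colClass_eq_zero {i : ℕ} {j : ℤ} {w : (resolvedHom F I G.cochainComplex).Fam}
    (h : w 0 (i + 1) (-j) = 0) : colClass S i j w = 0 := by
  rw [colClass_apply, extComp_eq_zero S h, map_zero]

lemma colClass_d {n : ℤ} {z : (resolvedHom F I G.cochainComplex).Fam}
    (hz : z ∈ (resolvedHom F I G.cochainComplex).cochains offCorner n) (i : ℕ) (j : ℤ) :
    colClass S i j ((resolvedHom F I G.cochainComplex).d z) = 0 := by
  rw [colClass_apply, extComp]
  rcases i with _ | i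
  · rw [leftComp_d_zero (hz.2 0 0 _ fun h => by simp [offCorner] at h), map_zsmul, map_zsmul, rTensor_lTensor_comm, tensorClass_lTensor_d,
      smul_zero]
  · rw [leftComp_d_succ, map_add, ← LinearMap.rTensor_comp_apply, S.π_d, LinearMap.rTensor_zero,
      LinearMap.zero_apply, zero_add, map_zsmul, map_zsmul, rTensor_lTensor_comm,
      tensorClass_lTensor_d, smul_zero]

variable {S} {n : ℤ} {w : (resolvedHom F I G.cochainComplex).Fam}

lemma SocleRetract.rTensor_zero (S : SocleRetract I) {P : Type u} [AddCommGroup P] [Module R P]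
    (t : (k →ₗ[R] I.cocomplex.X 0) ⊗[R] P) : t = (S.σ 0).rTensor P ((S.π 0).rTensor P t) +
      (S.s 0).rTensor P ((socleD I 0).rTensor P t) := by
  have e := congrArg (fun f => f.rTensor P t) S.homotopy_zero
  simpa only [LinearMap.rTensor_id, LinearMap.id_apply, LinearMap.rTensor_add, LinearMap.add_apply,
    LinearMap.rTensor_comp_apply] using e

lemma SocleRetract.rTensor_succ (S : SocleRetract I) (i : ℕ) {P : Type u} [AddCommGroup P]
    [Module R P] (t : (k →ₗ[R] I.cocomplex.X (i + 1)) ⊗[R] P) :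
    t = (S.σ (i + 1)).rTensor P ((S.π (i + 1)).rTensor P t) +
      (socleD I i).rTensor P ((S.s i).rTensor P t) +
        (S.s (i + 1)).rTensor P ((socleD I (i + 1)).rTensor P t) := by
  have e := congrArg (fun f => f.rTensor P t) (S.homotopy_succ i)
  simpa only [LinearMap.rTensor_id, LinearMap.id_apply, LinearMap.rTensor_add, LinearMap.add_apply,
    LinearMap.rTensor_comp_apply] using e

lemma SocleRetract.rTensor_d_σ (S : SocleRetract I) (i : ℕ) {P : Type u} [AddCommGroup P]
    [Module R P] (t : ExtResidue R i ⊗[R] P) :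
    (socleD I i).rTensor P ((S.σ i).rTensor P t) = 0 := by
  rw [← LinearMap.rTensor_comp_apply, S.d_σ, LinearMap.rTensor_zero, LinearMap.zero_apply]

/-- The primitive is chosen to be zero wherever `w` vanishes, so that the family built from these
primitives stays bounded. -/
lemma exists_lTensor_d_eq_extComp
    (hw : w ∈ (resolvedHom F I G.cochainComplex).cochains offCorner n)
    (hdw : ∀ y q, (resolvedHom F I G.cochainComplex).d w 0 y q = 0)
    (h : ∀ (i : ℕ) (j : ℤ), (i : ℤ) - j = n → colClass S i j w = 0) (i : ℕ) (p : ℤ) :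
    ∃ y : ExtResidue R i ⊗[R] G.cochainComplex.X p,
      (∀ q, p + 1 = q → (G.cochainComplex.d p q).hom.lTensor _ y = extComp S w i q) ∧
      (w 0 (i + 1) (p + 1) = 0 → y = 0) := by
  by_cases hp : w 0 (i + 1) (p + 1) = 0
  · refine ⟨0, ?_, fun _ => rfl⟩
    rintro q rfl
    rw [map_zero, extComp_eq_zero S hp]
  · have hdeg := not_imp_comm.1 (hw.2 0 (i + 1) (p + 1)) hp
    obtain ⟨j, rfl⟩ : ∃ j, p = -j - 1 := ⟨-p - 1, by lia⟩
    obtain ⟨y, hy⟩ := exists_lTensor_d_eq_of_tensorClass_eq_zero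
      (lTensor_d_extComp (S := S) hw hdw i (-j) (-j + 1) rfl) (h i j (by lia))
    refine ⟨y, fun q hq => ?_, fun h0 => absurd h0 hp⟩
    obtain rfl : q = -j := by lia
    exact hy

-- The retraction gives `w = σ π w + D s w + s D w` with `D` the socle differential. By hypothesis
-- `π w` is a boundary for the differential of `G`, and the cocycle condition rewrites `D w` as a
-- differential of `G`, so every term is part of a coboundary.
set_option maxHeartbeats 800000 in
lemma exists_left_eq_d
    (hw : w ∈ (resolvedHom F I G.cochainComplex).cochains offCorner n)
    (hdw : ∀ y q, (resolvedHom F I G.cochainComplex).d w 0 y q = 0)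
    (h : ∀ (i : ℕ) (j : ℤ), (i : ℤ) - j = n → colClass S i j w = 0) :
    ∃ e ∈ (resolvedHom F I G.cochainComplex).cochains (fun x y => bottom y x) (n - 1),
      ∀ y q, w 0 y q = (resolvedHom F I G.cochainComplex).d e 0 y q := by
  choose y hy hy0 using exists_lTensor_d_eq_extComp hw hdw h
  -- The first summand accounts for the homotopy terms, the second for `σ π w`. Its sign cancels the
  -- one carried by `dz` at height `i + 1`.
  let c (i : ℕ) (q : ℤ) : (k →ₗ[R] I.cocomplex.X i) ⊗[R] G.cochainComplex.X q :=
    (S.s i).rTensor _ (leftComp w (i + 1) q) +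
      (((i + 1 : ℕ) : ℤ).negOnePow : ℤ) • (S.σ i).rTensor _ (y i q)
  have hc (i : ℕ) (q : ℤ) (h1 : w 0 (i + 1 + 1) q = 0) (h2 : w 0 (i + 1) (q + 1) = 0) :
      c i q = 0 := by
    simp only [c, leftComp_eq_zero h1, hy0 i q h2, map_zero, smul_zero, add_zero]
  let e : (resolvedHom F I G.cochainComplex).Fam
    | 0, i + 1, q => leftEquiv F G i q (c i q)
    | 0, 0, _ => 0
    | _ + 1, _, _ => 0
  have hlc (i : ℕ) (q : ℤ) : leftComp e i q = c i q := LinearEquiv.symm_apply_apply _ _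
  have hdc (i : ℕ) (q : ℤ) : (((i + 1 : ℕ) : ℤ).negOnePow : ℤ) •
      (G.cochainComplex.d (q - 1) q).hom.lTensor _ (c i (q - 1)) =
        (S.s i).rTensor _ ((socleD I i).rTensor _ (leftComp w i q)) +
          (S.σ i).rTensor _ (extComp S w i q) := by
    rw [socleD_leftComp hdw, ← hy i (q - 1) q (by lia)]
    simp only [c]
    rw [map_add, map_zsmul, smul_add, negOnePow_smul_smul, map_zsmul,
      ← rTensor_lTensor_comm, ← rTensor_lTensor_comm]
  obtain ⟨b, hb⟩ := hw.1
  -- The bound drops by one because `y i q` depends on the component of `w` in degree `q + 1`.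
  refine ⟨e, ⟨⟨b - 1, ?_⟩, ?_⟩, ?_⟩
  · rintro (_ | x) (_ | i) q hq
    · rfl
    · exact (congrArg _ (hc i q (hb _ _ _ (by lia)) (hb _ _ _ (by lia)))).trans (map_zero _)
    · rfl
    · rfl
  · rintro (_ | x) (_ | i) q hq
    · rfl
    · refine (congrArg _ (hc i q (hw.2 _ _ _ ?_) (hw.2 _ _ _ ?_))).trans (map_zero _) <;>
      · rintro ⟨hd, -⟩
        exact hq ⟨by push_cast at hd ⊢; lia, Nat.succ_pos _, rfl⟩
    · rfl
    · rfl
  · rintro (_ | _ | i) q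
    · rw [hw.2 0 0 q fun h => by simp [offCorner] at h, d_apply]
      simp only [dX, dY, dZ, e, map_zero, add_zero]
    · refine (leftEquiv F G 0 q).symm.injective ?_
      change leftComp w 0 q = leftComp _ 0 q
      rw [leftComp_d_zero rfl, hlc, hdc]
      refine (S.rTensor_zero (leftComp w 0 q)).trans ?_
      rw [add_comm]
      rfl
    · refine (leftEquiv F G (i + 1) q).symm.injective ?_
      change leftComp w (i + 1) q = leftComp _ (i + 1) q
      rw [leftComp_d_succ, hlc, hlc, hdc]
      simp only [c]
      rw [map_add, ← map_zsmul, S.rTensor_d_σ, add_zero]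
      refine (S.rTensor_succ i _).trans ?_
      rw [add_assoc]
      exact (add_comm _ _).trans (add_assoc _ _ _)

variable (S) in
lemma exists_left_colClass_eq (i : ℕ) (j : ℤ) (t : ExtResidue R i ⊗[k] TorResidue G j) :
    ∃ v ∈ (resolvedHom F I G.cochainComplex).cochains (fun x y => bottom y x) ((i : ℤ) - j),
      (∀ y q, (resolvedHom F I G.cochainComplex).d v 0 y q = 0) ∧ colClass S i j v = t ∧
        ∀ (i' : ℕ) (j' : ℤ), i' ≠ i → colClass S i' j' v = 0 := by
  obtain ⟨x, hx, rfl⟩ := exists_tensorClass_eq t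
  -- A single component suffices: `x` is a cycle for the differential of `G`, and `σ` takes values
  -- in socle cocycles.
  let v : (resolvedHom F I G.cochainComplex).Fam :=
    Pi.single 0 (Pi.single (i + 1) (Pi.single (-j) (leftEquiv F G i (-j) ((S.σ i).rTensor _ x))))
  have hv : v 0 (i + 1) (-j) = leftEquiv F G i (-j) ((S.σ i).rTensor _ x) := by simp [v]
  have hcycle (p : ℤ) (hp : -j = p) (q : ℤ) (hq : p + 1 = q) :
      (G.cochainComplex.d p q).hom.lTensor _ (leftComp v i p) = 0 := by
    subst hp hq
    rw [leftComp, hv, LinearEquiv.symm_apply_apply, ← rTensor_lTensor_comm, hx, map_zero]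
  have hv0 (a b : ℕ) (q : ℤ) (h : ¬ (a = 0 ∧ b = i + 1 ∧ q = -j)) : v a b q = 0 := by
    by_cases ha : a = 0
    · subst ha
      by_cases hb : b = i + 1
      · subst hb
        simp only [v, Pi.single_eq_same]
        exact Pi.single_eq_of_ne (fun hq => h ⟨rfl, rfl, hq⟩) _
      · simp only [v, Pi.single_eq_same]
        rw [Pi.single_eq_of_ne hb]
        rfl
    · simp only [v]
      rw [Pi.single_eq_of_ne ha]
      rfl
  refine ⟨v, ⟨⟨-j, fun a b q hq => hv0 a b q (by lia)⟩, fun a b q hq => hv0 a b q ?_⟩, ?_, ?_,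
    fun i' j' hi => colClass_eq_zero S (hv0 _ _ _ (by lia))⟩
  · rintro ⟨rfl, rfl, rfl⟩
    exact hq ⟨by push_cast; lia, Nat.succ_pos _, rfl⟩
  · intro b q
    have hY : dY v 0 b q = 0 := by
      rcases b with _ | b
      · rfl
      · by_cases hb : b = i + 1 ∧ q = -j
        · obtain ⟨rfl, rfl⟩ := hb
          simp only [dY]
          rw [hv, dy_leftEquiv, S.rTensor_d_σ, map_zero]
        · simp only [dY]
          rw [hv0 _ _ _ (by lia), map_zero]
    have hZ : dZ v 0 b q = 0 := by
      by_cases hb : b = i + 1 ∧ q - 1 = -j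
      · obtain ⟨rfl, hq⟩ := hb
        simp only [dZ]
        rw [← leftEquiv_leftComp v i (q - 1), dz_leftEquiv, hcycle (q - 1) hq.symm q (by lia),
          map_zero, smul_zero]
      · simp only [dZ]
        rw [hv0 _ _ _ (by lia), map_zero]
    rw [d_apply, hY, hZ]
    simp [dX]
  · rw [colClass_apply, extComp, leftComp, hv, LinearEquiv.symm_apply_apply,
      ← LinearMap.rTensor_comp_apply, S.π_σ, LinearMap.rTensor_id, LinearMap.id_apply]

end ColumnClass

end BoundedCohomology

/-! ### Components in direct sums -/

lemma DirectSum.toModule_zsmul_lof_comp_apply {K ι κ : Type*} [CommRing K] [DecidableEq ι]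
    [DecidableEq κ] {M : ι → Type*} {M' : κ → Type*} [∀ p, AddCommGroup (M p)]
    [∀ p, Module K (M p)] [∀ p, AddCommGroup (M' p)] [∀ p, Module K (M' p)] {σ : ι → κ}
    (hσ : Function.Injective σ) (c : ι → ℤ) (f : ∀ p, M p →ₗ[K] M' (σ p)) (x : ⨁ p, M p) (p : ι) :
    DirectSum.toModule K ι (⨁ q, M' q) (fun p => c p • (DirectSum.lof K κ M' (σ p) ∘ₗ f p)) x
      (σ p) = c p • f p (x p) := by
  induction x using DirectSum.induction_on with
  | zero => simp
  | add x y hx hy => rw [map_add, add_apply, hx, hy, add_apply, map_add, smul_add]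
  | of p' t =>
    rw [← DirectSum.lof_eq_of K, DirectSum.toModule_lof]
    change c p' • DirectSum.lof K κ M' (σ p') (f p' t) (σ p) = _
    by_cases hp : p = p'
    · subst hp
      rw [DirectSum.lof_apply, DirectSum.lof_apply]
    · rw [DirectSum.lof_eq_of, DirectSum.lof_eq_of, DirectSum.of_eq_of_ne _ _ _ (hσ.ne hp),
        DirectSum.of_eq_of_ne _ _ _ hp, map_zero, smul_zero, smul_zero]

lemma DirectSum.eq_of {ι : Type*} [DecidableEq ι] {M : ι → Type*} [∀ p, AddCommGroup (M p)]
    {x : ⨁ p, M p} {p : ι} {t : M p} (hp : x p = t) (h : ∀ p', p' ≠ p → x p' = 0) :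
    x = DirectSum.of M p t := by
  refine DFinsupp.ext fun p' => ?_
  by_cases e : p' = p
  · subst e
    exact hp.trans (DirectSum.of_eq_same _ _).symm
  · exact (h p' e).trans (DirectSum.of_eq_of_ne _ _ _ e).symm

/-! ### The two maps out of the total cocycles -/

namespace BoundedCohomology

open TripleComplex

section Comparison

variable {R : Type u} [CommRing R] [IsLocalRing R]

local notation "k" => IsLocalRing.ResidueField R

variable {N : ModuleCat.{u} R}
  {F : ProjectiveResolution (ModuleCat.of R (IsLocalRing.ResidueField R))}
  {I : InjectiveResolution (ModuleCat.of R R)} {G : ProjectiveResolution N}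

lemma colClass_congr (S : SocleRetract I) {v w : (resolvedHom F I G.cochainComplex).Fam}
    (h : ∀ y q, v 0 y q = w 0 y q) (i : ℕ) (j : ℤ) : colClass S i j v = colClass S i j w := by
  rw [colClass_apply, colClass_apply, extComp, extComp, leftComp, leftComp, h]

lemma extComp_famAct (S : SocleRetract I) {a : ℤ}
    (α : Cochain G.cochainComplex G.cochainComplex a)
    (w : (resolvedHom F I G.cochainComplex).Fam) (i : ℕ) (r q : ℤ) (h : r + a = q) :
    extComp S (famAct (augmentedProj F) (augmentedInj I) α w) i q =
      ((a * (i + 1 : ℕ)).negOnePow : ℤ) • (α.v r q h).hom.lTensor _ (extComp S w i r) := by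
  rw [extComp, leftComp, famAct_apply α w 0 (i + 1) q r h, ← leftEquiv_leftComp w i r,
    termAct_leftEquiv, map_zsmul, LinearEquiv.symm_apply_apply, map_zsmul, rTensor_lTensor_comm]
  rfl

/-- The exponent contains `i + 1` and not `i` because `I^i` sits at height `i + 1`. The surplus
factor `(-1)^a` does not depend on `i` and is removed at the end. -/
lemma colClass_famAct (S : SocleRetract I) {n a : ℤ}
    (α : Cocycle G.cochainComplex G.cochainComplex a)
    {w : (resolvedHom F I G.cochainComplex).Fam}
    (hw : w ∈ (resolvedHom F I G.cochainComplex).cochains offCorner n)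
    (hdw : (resolvedHom F I G.cochainComplex).d w = 0) (i : ℕ) {j l : ℤ} (h : l + a = j) :
    colClass S i l (famAct (augmentedProj F) (augmentedInj I) α.1 w) =
      ((a * (i + 1 : ℕ)).negOnePow : ℤ) •
        (torAct G h (CohomologyClass.mk α)).lTensor _ (colClass S i j w) := by
  rw [colClass_apply, extComp_famAct S α.1 w i (-j) (-l) (by lia), map_zsmul,
    tensorClass_lTensor_cocycle G h α
      (lTensor_d_extComp hw (fun y q => congrFun (congrFun (congrFun hdw 0) y) q) i _ _ rfl)]
  rfl

/-- The summands of `ExtTensorTor G n`. -/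
abbrev ExtTensorTorTerm (G : ProjectiveResolution N) (n : ℤ)
    (p : {p : ℕ × ℤ // (p.1 : ℤ) - p.2 = n}) : Type u :=
  ExtResidue R p.1.1 ⊗[k] TorResidue G p.1.2

lemma extTensorTorAct_apply {n a m : ℤ} (h : n + a = m) (ε : SelfExt G a) (x : ExtTensorTor G n)
    (i : ℕ) {j l : ℤ} (hl : l + a = j) (hp : (i : ℤ) - j = n) (hq : (i : ℤ) - l = m) :
    extTensorTorAct G h ε x ⟨(i, l), hq⟩ =
      ((a * i).negOnePow : ℤ) • (torAct G hl ε).lTensor _ (x ⟨(i, j), hp⟩) := by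
  obtain rfl : l = j - a := by lia
  exact DirectSum.toModule_zsmul_lof_comp_apply (M := ExtTensorTorTerm G n)
    (M' := ExtTensorTorTerm G m)
    (σ := fun p => ⟨(p.1.1, p.1.2 - a), by have := p.2; lia⟩)
    (fun p p' e => Subtype.ext (Prod.ext (congrArg (fun r => r.1.1) e)
      (sub_left_injective (congrArg (fun r => r.1.2) e))))
    (fun p => ((a * p.1.1).negOnePow : ℤ))
    (fun p => LinearMap.lTensor (ExtResidue R p.1.1)
      (torAct G (by lia : p.1.2 - a + a = p.1.2) ε)) x ⟨(i, j), hp⟩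

variable (F I G) in
/-- The cocycles of the total complex. -/
noncomputable def totalCocycles (n : ℤ) : Submodule R (resolvedHom F I G.cochainComplex).Fam :=
  (resolvedHom F I G.cochainComplex).cochains offCorner n ⊓
    LinearMap.ker (resolvedHom F I G.cochainComplex).d

lemma famAct_mem_totalCocycles {n a m : ℤ} (h : n + a = m)
    (α : Cocycle G.cochainComplex G.cochainComplex a)
    {w : (resolvedHom F I G.cochainComplex).Fam} (hw : w ∈ totalCocycles F I G n) :
    famAct (augmentedProj F) (augmentedInj I) α.1 w ∈ totalCocycles F I G m :=
  ⟨famAct_mem h α.1 hw.1, by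
    change (resolvedHom F I G.cochainComplex).d _ = 0
    rw [d_famAct, LinearMap.mem_ker.1 hw.2, map_zero]
    exact smul_zero _⟩

variable (F I G) in
/-- The class in `\overline{Ext}(k, N)` of a cocycle of the total complex. -/
noncomputable def totalToExtb (n : ℤ) : totalCocycles F I G n →ₗ[R] Extb F G n :=
  Submodule.mkQ _ ∘ₗ (bottomCochain F I G.cochainComplex n ∘ₗ
    (totalCocycles F I G n).subtype).codRestrict _ fun w =>
      ⟨bottomCochain_mem w.2.1, by
        change δ n (n + 1) _ = 0
        exact (δ_bottomCochain rfl w.2.1).trans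
          ((congrArg _ (LinearMap.mem_ker.1 w.2.2)).trans (map_zero _))⟩

/-- A nonzero class needs `-j ≥ b`, and then `i = n + j ≤ n - b`. Boundedness is thus what produces
a direct sum. -/
lemma finite_colClass_ne_zero (S : SocleRetract I) {n : ℤ}
    {w : (resolvedHom F I G.cochainComplex).Fam}
    (hw : w ∈ (resolvedHom F I G.cochainComplex).cochains offCorner n) :
    {p : {p : ℕ × ℤ // (p.1 : ℤ) - p.2 = n} | colClass S p.1.1 p.1.2 w ≠ 0}.Finite := by
  obtain ⟨b, hb⟩ := hw.1
  refine ((Set.finite_Iic (n - b).toNat).preimage (f := fun p => p.1.1) ?_).subset ?_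
  · rintro ⟨⟨i, j⟩, hp⟩ - ⟨⟨i', j'⟩, hp'⟩ - h
    obtain rfl : i = i' := h
    obtain rfl : j = j' := by lia
    rfl
  · rintro ⟨⟨i, j⟩, hp⟩ h
    have hj : b ≤ -j := not_lt.1 fun hj => h (colClass_eq_zero S (hb _ _ _ hj))
    change i ≤ (n - b).toNat
    lia

/-- The class in `Ext(k, R) ⊗ Tor(k, N)` of a cocycle of the total complex. -/
noncomputable def totalToExtTensorTor (S : SocleRetract I) (n : ℤ) :
    totalCocycles F I G n →ₗ[R] ExtTensorTor G n :=
  DirectSum.ofFiniteSupport (M := ExtTensorTorTerm G n)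
    (fun p => colClass S p.1.1 p.1.2 ∘ₗ (totalCocycles F I G n).subtype)
    fun w => finite_colClass_ne_zero S w.2.1

lemma totalToExtTensorTor_apply (S : SocleRetract I) {n : ℤ} (w : totalCocycles F I G n) {i : ℕ}
    {j : ℤ} (hp : (i : ℤ) - j = n) :
    totalToExtTensorTor S n w ⟨(i, j), hp⟩ = colClass S i j w.1 :=
  DirectSum.ofFiniteSupport_apply (M := ExtTensorTorTerm G n) _ _ w ⟨(i, j), hp⟩

lemma totalToExtTensorTor_famAct (S : SocleRetract I) {n a m : ℤ} (h : n + a = m)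
    (α : Cocycle G.cochainComplex G.cochainComplex a) (w : totalCocycles F I G n) :
    totalToExtTensorTor S m ⟨_, famAct_mem_totalCocycles h α w.2⟩ =
      (a.negOnePow : ℤ) •
        extTensorTorAct G h (CohomologyClass.mk α) (totalToExtTensorTor S n w) := by
  refine DFinsupp.ext fun p => ?_
  obtain ⟨⟨i, l⟩, hp⟩ := p
  refine (totalToExtTensorTor_apply S _ hp).trans ?_
  rw [colClass_famAct S α w.2.1 (LinearMap.mem_ker.1 w.2.2) i (rfl : l + a = l + a)]
  change _ = (a.negOnePow : ℤ) •
    (extTensorTorAct G h (CohomologyClass.mk α) (totalToExtTensorTor S n w)) ⟨(i, l), hp⟩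
  rw [extTensorTorAct_apply h _ _ i (rfl : l + a = l + a) (by lia) hp, totalToExtTensorTor_apply,
    smul_smul, ← Units.val_mul, ← Int.negOnePow_add, Nat.cast_succ, mul_add, mul_one, add_comm a]

-- A bounded cocycle of `Hom(F, G)` is placed on the bottom row and extended through the exact rows.
variable (F I G) in
lemma totalToExtb_surjective [IsNoetherianRing R] (n : ℤ) :
    Function.Surjective (totalToExtb F I G n) := by
  intro x
  obtain ⟨⟨β, hβ⟩, rfl⟩ := Submodule.mkQ_surjective _ x
  obtain ⟨v, hv, rfl⟩ := exists_bottomCochain_eq (I := I) hβ.1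
  have hδ : δ n (n + 1) (bottomCochain F I G.cochainComplex n v) = 0 := hβ.2
  rw [δ_bottomCochain rfl (bottom_offCorner hv)] at hδ
  obtain ⟨w, hw, hdw, h⟩ := (resolvedHom_rowsExact F I G.cochainComplex
    (projective_cochainComplex G)).exists_extension hv
    (eq_zero_of_bottomCochain_eq_zero (d_mem_offCorner rfl (bottom_offCorner hv)) hδ)
  refine ⟨⟨w, hw, hdw⟩, congrArg (Submodule.mkQ _) (Subtype.ext ?_)⟩
  exact bottomCochain_congr fun x q => h x q

-- Each homogeneous tensor is represented by a cocycle of the left column, which extends through the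
-- exact columns.
variable (F G) in
lemma totalToExtTensorTor_surjective (S : SocleRetract I) (n : ℤ) :
    Function.Surjective (totalToExtTensorTor (F := F) (G := G) S n) := by
  intro x
  induction x using DirectSum.induction_on with
  | zero => exact ⟨0, map_zero _⟩
  | add x y hx hy =>
    obtain ⟨v, rfl⟩ := hx
    obtain ⟨w, rfl⟩ := hy
    exact ⟨v + w, map_add _ _ _⟩
  | of p t =>
    obtain ⟨⟨i, j⟩, rfl⟩ := p
    obtain ⟨v, hv, hdv, rfl, hv0⟩ := exists_left_colClass_eq (F := F) S i j t
    obtain ⟨w, hw, hdw, h⟩ := exists_extension_of_left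
      (resolvedHom_swap_rowsExact F I G.cochainComplex (projective_cochainComplex G)) hv hdv
    refine ⟨⟨w, hw, hdw⟩, DirectSum.eq_of (M := ExtTensorTorTerm G _) (p := ⟨(i, j), rfl⟩)
      ((totalToExtTensorTor_apply S _ rfl).trans (colClass_congr S h i j)) ?_⟩
    rintro ⟨⟨i', j'⟩, hp⟩ hne
    refine (totalToExtTensorTor_apply S _ hp).trans ((colClass_congr S h i' j').trans ?_)
    refine hv0 i' j' fun hi => hne (Subtype.ext (Prod.ext hi ?_))
    change (i' : ℤ) - j' = i - j at hp
    change j' = j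
    lia

/-- Both kernels consist of the total coboundaries: a class that vanishes on one edge makes the
whole cocycle a coboundary, and coboundaries have trivial class on the other edge. -/
lemma ker_totalToExtb [IsNoetherianRing R] (S : SocleRetract I) (n : ℤ) :
    LinearMap.ker (totalToExtb F I G n) = LinearMap.ker (totalToExtTensorTor S n) := by
  ext ⟨w, hw, hdw⟩
  have hdw' : (resolvedHom F I G.cochainComplex).d w = 0 := hdw
  rw [LinearMap.mem_ker, LinearMap.mem_ker]
  constructor
  · intro h
    obtain ⟨γ, hγ, hδ⟩ := (Submodule.Quotient.mk_eq_zero _).1 h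
    obtain ⟨e, he, rfl⟩ := exists_bottomCochain_eq (I := I) hγ
    have hδ' : δ (n - 1) n (bottomCochain F I G.cochainComplex (n - 1) e) =
      bottomCochain F I G.cochainComplex n w := hδ
    rw [δ_bottomCochain (by lia) (bottom_offCorner he), eq_comm, ← sub_eq_zero, ← map_sub] at hδ'
    obtain ⟨z, hz, rfl⟩ := (resolvedHom_rowsExact F I G.cochainComplex
      (projective_cochainComplex G)).exists_d_eq_of_bottom hw hdw' he fun x q =>
        sub_eq_zero.1 (eq_zero_of_bottomCochain_eq_zero
          (sub_mem hw (d_mem_offCorner (by lia) (bottom_offCorner he))) hδ' x q)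
    refine DFinsupp.ext ?_
    rintro ⟨⟨i, j⟩, hp⟩
    exact (totalToExtTensorTor_apply S _ hp).trans (colClass_d S hz i j)
  · intro h
    obtain ⟨e, he, hwe⟩ := exists_left_eq_d (S := S) hw
      (fun y q => congrFun (congrFun (congrFun hdw' 0) y) q) fun i j hp => by
        rw [← totalToExtTensorTor_apply S ⟨w, hw, hdw⟩ hp, h]
        rfl
    obtain ⟨z, hz, rfl⟩ := exists_d_eq_of_left
      (resolvedHom_swap_rowsExact F I G.cochainComplex (projective_cochainComplex G)) hw hdw' he hwe
    refine (Submodule.Quotient.mk_eq_zero _).2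
      ⟨bottomCochain F I G.cochainComplex (n - 1) z, bottomCochain_mem hz, ?_⟩
    exact δ_bottomCochain (by lia) hz

end Comparison

end BoundedCohomology

lemma LinearMap.exists_equiv_of_ker_eq {R K Z A B : Type*} [CommRing R] [CommRing K] [Algebra R K]
    (hK : Function.Surjective (algebraMap R K)) [AddCommGroup Z] [Module R Z] [AddCommGroup A]
    [Module R A] [Module K A] [IsScalarTower R K A] [AddCommGroup B] [Module R B] [Module K B]
    [IsScalarTower R K B] {f : Z →ₗ[R] A} {g : Z →ₗ[R] B} (hf : Function.Surjective f)
    (hg : Function.Surjective g) (h : LinearMap.ker f = LinearMap.ker g) (c : ℤˣ) :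
    ∃ e : A ≃ₗ[K] B, ∀ z, e (f z) = (c : ℤ) • g z := by
  -- Both targets are the quotient of `Z` by the common kernel. Linearity over `K` is automatic
  -- because scalars from `R` already exhaust `K`.
  let e := (f.quotKerEquivOfSurjective hf).symm ≪≫ₗ Submodule.quotEquivOfEq _ _ h ≪≫ₗ
    g.quotKerEquivOfSurjective hg
  refine ⟨LinearEquiv.extendScalarsOfSurjective hK e ≪≫ₗ DistribMulAction.toLinearEquiv K B c,
    fun z => ?_⟩
  have hz : (f.quotKerEquivOfSurjective hf).symm (f z) = Submodule.Quotient.mk z :=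
    (LinearEquiv.symm_apply_eq _).2 rfl
  change c • g.quotKerEquivOfSurjective hg (Submodule.quotEquivOfEq _ _ h
    ((f.quotKerEquivOfSurjective hf).symm (f z))) = (c : ℤ) • g z
  rw [hz]
  rfl

lemma DirectSum.nonempty_equiv_of_subsingleton {K ι κ : Type*} [CommRing K] [DecidableEq ι]
    [DecidableEq κ] {M : ι → Type*} [∀ p, AddCommGroup (M p)] [∀ p, Module K (M p)] {σ : κ → ι}
    (hσ : Function.Injective σ) (h : ∀ p, p ∉ Set.range σ → Subsingleton (M p)) :
    Nonempty ((⨁ p, M p) ≃ₗ[K] ⨁ q, M (σ q)) := by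
  let f : (⨁ q, M (σ q)) →ₗ[K] ⨁ p, M p :=
    DirectSum.toModule K κ _ fun q => (1 : ℤ) • (DirectSum.lof K ι M (σ q) ∘ₗ LinearMap.id)
  have hf (x : ⨁ q, M (σ q)) (q : κ) : f x (σ q) = x q :=
    (DirectSum.toModule_zsmul_lof_comp_apply hσ (fun _ => 1) (fun _ => LinearMap.id) x q).trans
      (one_smul _ _)
  refine ⟨(LinearEquiv.ofBijective f ⟨fun x y e => DFinsupp.ext fun q => ?_, fun x => ?_⟩).symm⟩
  · rw [← hf, ← hf, e]
  · induction x using DirectSum.induction_on with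
    | zero => exact ⟨0, map_zero f⟩
    | add x y hx hy =>
      obtain ⟨v, rfl⟩ := hx
      obtain ⟨w, rfl⟩ := hy
      exact ⟨v + w, map_add f v w⟩
    | of p t =>
      by_cases hp : p ∈ Set.range σ
      · obtain ⟨q, rfl⟩ := hp
        refine ⟨DirectSum.lof K κ (fun q => M (σ q)) q t, ?_⟩
        rw [DirectSum.toModule_lof, one_smul, LinearMap.comp_id, DirectSum.lof_eq_of]
      · have := h p hp
        exact ⟨0, by rw [map_zero, Subsingleton.elim t 0, map_zero]⟩

/-! ### The equivariant isomorphism and its degreewise form -/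

namespace BoundedCohomology

section Comparison

variable {R : Type u} [CommRing R] [IsLocalRing R]

local notation "k" => IsLocalRing.ResidueField R

variable {N : ModuleCat.{u} R}

instance isScalarTower_extb (F : ProjectiveResolution (ModuleCat.of R k))
    (G : ProjectiveResolution N) (n : ℤ) : IsScalarTower R k (Extb F G n) :=
  Module.IsTorsionBySet.isScalarTower (R := R) (I := IsLocalRing.maximalIdeal R)
    fun _ r => smul_extb_eq_zero F G n r (smul_residueField_eq_zero r.1 r.2) _

instance isScalarTower_extTensorTor (G : ProjectiveResolution N) (n : ℤ) :
    IsScalarTower R k (ExtTensorTor G n) where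
  smul_assoc r c _ := DFinsupp.ext fun _ => smul_assoc r c _

lemma subsingleton_torResidue (G : ProjectiveResolution N) {j : ℤ} (hj : j < 0) :
    Subsingleton (TorResidue G j) := by
  have h := (ModuleCat.extendScalars.{u, u, u} (algebraMap R k)).map_isZero
    (CochainComplex.isZero_of_isStrictlyLE G.cochainComplex 0 (-j) (by lia))
  have : Subsingleton ((residueTensor G.cochainComplex).X (-j)) :=
    ModuleCat.subsingleton_of_isZero h
  infer_instance

variable {F : ProjectiveResolution (ModuleCat.of R (IsLocalRing.ResidueField R))}
  {I : InjectiveResolution (ModuleCat.of R R)} {G : ProjectiveResolution N}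

lemma extbAct_totalToExtb {n a m : ℤ} (h : n + a = m)
    (α : Cocycle G.cochainComplex G.cochainComplex a) (w : totalCocycles F I G n) :
    extbAct F G h (CohomologyClass.mk α) (totalToExtb F I G n w) =
      totalToExtb F I G m ⟨_, famAct_mem_totalCocycles h α w.2⟩ :=
  congrArg (Submodule.mkQ _) (Subtype.ext (bottomCochain_famAct h α.1 w.1).symm)

variable (F G) in
lemma exists_extb_equiv [IsNoetherianRing R] : ∃ φ : ∀ n : ℤ, Extb F G n ≃ₗ[k] ExtTensorTor G n,
    ∀ (n a m : ℤ) (h : n + a = m) (ε : SelfExt G a) (x : Extb F G n),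
      φ m (extbAct F G h ε x) = extTensorTorAct G h ε (φ n x) := by
  let I : InjectiveResolution (ModuleCat.of R R) := InjectiveResolution.of _
  obtain ⟨S⟩ := nonempty_socleRetract I
  choose φ hφ using fun n : ℤ => LinearMap.exists_equiv_of_ker_eq (K := k)
    IsLocalRing.residue_surjective (totalToExtb_surjective F I G n)
    -- The twist by `(-1)^n` absorbs the factor `(-1)^a` of `totalToExtTensorTor_famAct`, since `m +
    -- a = n + 2 a` has the parity of `n`.
    (totalToExtTensorTor_surjective F G S n) (ker_totalToExtb S n) n.negOnePow
  refine ⟨φ, fun n a m h ε x => ?_⟩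
  obtain ⟨α, rfl⟩ := CohomologyClass.mk_surjective ε
  obtain ⟨w, rfl⟩ := totalToExtb_surjective F I G n x
  rw [extbAct_totalToExtb, hφ, hφ, totalToExtTensorTor_famAct, map_zsmul, smul_smul,
    ← Units.val_mul, ← Int.negOnePow_add]
  have e : (m + a).negOnePow = n.negOnePow := by
    rw [← h, add_assoc, Int.negOnePow_add, Int.negOnePow_add, Int.units_mul_self, mul_one]
  rw [e]

-- `G` is zero in negative homological degrees, so the summands with `j < 0` vanish and `j` may
-- range over the natural numbers.
variable (G) in
lemma nonempty_extTensorTor_equiv (n : ℤ) : Nonempty (ExtTensorTor G n ≃ₗ[k]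
    ⨁ p : {p : ℕ × ℕ // (p.1 : ℤ) - (p.2 : ℤ) = n},
      ExtResidue R p.1.1 ⊗[k] TorResidue G (p.1.2 : ℤ)) := by
  refine DirectSum.nonempty_equiv_of_subsingleton (M := ExtTensorTorTerm G n)
    (σ := fun p : {p : ℕ × ℕ // (p.1 : ℤ) - (p.2 : ℤ) = n} => ⟨(p.1.1, p.1.2), p.2⟩) ?_ ?_
  · rintro ⟨⟨i, j⟩, h⟩ ⟨⟨i', j'⟩, h'⟩ e
    have e1 : i = i' := congrArg (fun r => r.1.1) e
    have e2 : (j : ℤ) = j' := congrArg (fun r => r.1.2) e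
    exact Subtype.ext (Prod.ext e1 (by exact_mod_cast e2))
  · rintro ⟨⟨i, j⟩, h⟩ hp
    have := subsingleton_torResidue G (j := j) (not_le.1 fun hj => by
      lift j to ℕ using hj
      exact hp ⟨⟨(i, j), h⟩, rfl⟩)
    exact TensorProduct.uniqueRight.instSubsingleton

end Comparison

end BoundedCohomology

theorem mainTheorem8 {R : Type u} [CommRing R] [IsLocalRing R] [IsNoetherianRing R]
    (N : ModuleCat.{u} R)
    (F : ProjectiveResolution (ModuleCat.of R (IsLocalRing.ResidueField R)))
    (G : ProjectiveResolution N) :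
    (∃ φ : ∀ n : ℤ, BoundedCohomology.Extb F G n ≃ₗ[IsLocalRing.ResidueField R]
        BoundedCohomology.ExtTensorTor G n,
      ∀ (n a m : ℤ) (h : n + a = m) (ε : BoundedCohomology.SelfExt G a)
        (x : BoundedCohomology.Extb F G n),
        φ m (BoundedCohomology.extbAct F G h ε x) =
          BoundedCohomology.extTensorTorAct G h ε (φ n x)) ∧
    ∀ n : ℤ, Nonempty (BoundedCohomology.Extb F G n ≃ₗ[IsLocalRing.ResidueField R]
      ⨁ p : {p : ℕ × ℕ // (p.1 : ℤ) - (p.2 : ℤ) = n},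
        BoundedCohomology.ExtResidue R p.1.1 ⊗[IsLocalRing.ResidueField R]
          BoundedCohomology.TorResidue G (p.1.2 : ℤ)) := by
  obtain ⟨φ, hφ⟩ := BoundedCohomology.exists_extb_equiv F G
  refine ⟨⟨φ, hφ⟩, fun n => ?_⟩
  obtain ⟨e⟩ := BoundedCohomology.nonempty_extTensorTor_equiv G n
  exact ⟨(φ n).trans e⟩
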